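/- Fix integers $d\ge 2$, $D\ge 0$, $r\ge 0$. On a ring of $L$ qudits with Hilbert space $(\mathbb{C}^d)^{\otimes L}$ let $T$ be the translation by one site, $P_{\mathcal T}=\frac1L\sum_{n=0}^{L-1}T^n$ the projector onto the zero-momentum subspace, and $\rho_{\mathcal T}=P_{\mathcal T}/\operatorname{Tr}P_{\mathcal T}$ the maximally mixed translation-invariant state. A local unitary circuit of depth $D$ and range $r$ is a product of $D$ layers, each of which is a product of unitary gates acting on pairwise disjoint contiguous regions of at most $r$ sites (a layer may be trivial). (i) ($\rho_{\mathcal T}$ is long-range bipartite entangled for large $L$.) There is $L_0=L_0(d,D,r)$ such that for every $L\ge L_0$ the state $\rho_{\mathcal T}$ is not a mixture $\sum_\alpha p_\alpha|\psi_\alpha\rangle\langle\psi_\alpha|$ (with $p_\alpha\ge0$, $\sum_\alpha p_\alpha=1$) of pure states of the form $|\psi_\alpha\rangle=U_\alpha|A_\alpha\rangle|B_\alpha\rangle$, where $U_\alpha$ is a local unitary circuit of depth $D$ and range $r$ and $|A_\alpha\rangle$, $|B_\alpha\rangle$ are normalized states of two complementary nonempty contiguous regions of the ring. The circuits and the regions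 may depend on $\alpha$. (ii) There are $\ell$, $D'$, $r'$, depending only on $d$, $D$ and $r$, such that for every $L$ the following holds. Let $|\Psi\rangle\in(\mathbb{C}^d)^{\otimes L}$ be translationally symmetric, i.e. $T|\Psi\rangle\propto|\Psi\rangle$, and of the form $|\Psi\rangle=U|A\rangle|B\rangle$, where $U$ is a local unitary circuit of depth $D$ and range $r$ and $|A\rangle$, $|B\rangle$ are normalized states of two complementary contiguous regions of at least $\ell$ sites each. Then $|\Psi\rangle=V\,|\phi_1\rangle\otimes\cdots\otimes|\phi_L\rangle$ for some local unitary circuit $V$ of depth $D'$ and range $r'$ and some normalized single-site states $|\phi_i\rangle\in\mathbb{C}^d$. -/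

import Mathlib

open scoped Matrix

noncomputable section

namespace TranslationMMIS

/-- Labels `σ = (σ₁, …, σ_L)` of the computational basis of a chain of `L` qudits of dimension `d`;
the sites `Fin L` form a ring, with `finRotate L : i ↦ i + 1 mod L` as the shift of sites. -/
abbrev Config (d L : ℕ) : Type := Fin L → Fin d

/-- The Hilbert space `(ℂ^d)^{⊗ L}`, written in the computational basis. -/
abbrev Ket (d L : ℕ) : Type := EuclideanSpace ℂ (Config d L)

/-- Operators on `(ℂ^d)^{⊗ L}`, as matrices in the computational basis. -/
abbrev Op (d L : ℕ) : Type := Matrix (Config d L) (Config d L) ℂ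

/-- The translation by one site: `T |τ⟩ = |σ⟩` with `σ (i + 1) = τ i`. -/
def translation (d L : ℕ) : Op d L :=
  Matrix.of fun σ τ => if τ = σ ∘ finRotate L then 1 else 0

/-- `P = (1 / L) (1 + T + ⋯ + T ^ (L - 1))`, the projector onto the zero-momentum subspace. -/
def translationProjector (d L : ℕ) : Op d L :=
  (L : ℂ)⁻¹ • ∑ n ∈ Finset.range L, translation d L ^ n

/-- The maximally mixed invariant state of translation: `P` normalized to trace one. -/
def mmis (d L : ℕ) : Op d L :=
  (translationProjector d L).trace⁻¹ • translationProjector d L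

variable {d L : ℕ}

/-- The rank-one operator `|Ψ⟩⟨Ψ|`. -/
def ketBra (Ψ : Ket d L) : Op d L :=
  Matrix.vecMulVec Ψ.ofLp (star Ψ.ofLp)

/-- `Ψ` is an eigenvector of translation, with any momentum. -/
def IsTranslationSymmetric (Ψ : Ket d L) : Prop :=
  ∃ c : ℂ, translation d L *ᵥ Ψ.ofLp = c • Ψ.ofLp

/-- The contiguous region of the ring that consists of `i, i + 1, …, i + n - 1` (mod `L`). -/
def arc (i : Fin L) (n : ℕ) : Finset (Fin L) :=
  (Finset.range n).image fun k => (finRotate L ^ k) i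

/-- `S` is a contiguous region of the ring. -/
def IsArc (S : Finset (Fin L)) : Prop :=
  ∃ (i : Fin L) (n : ℕ), S = arc i n

/-- `M = u ⊗ 1` for some operator `u` on the sites in `S`. -/
def ActsOn (S : Finset (Fin L)) (M : Op d L) : Prop :=
  ∃ u : Matrix (S → Fin d) (S → Fin d) ℂ, ∀ σ τ : Config d L,
    M σ τ = if ∀ i ∉ S, σ i = τ i then u (S.restrict σ) (S.restrict τ) else 0

/-- A layer of a local circuit: a product of finitely many unitary gates that act on pairwise
disjoint contiguous regions of at most `r` sites each. -/
def IsLocalLayer (r : ℕ) (M : Op d L) : Prop :=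
  ∃ (n : ℕ) (S : Fin n → Finset (Fin L)) (G : Fin n → Op d L),
    (∀ j k, j ≠ k → Disjoint (S j) (S k)) ∧
    (∀ k, IsArc (S k) ∧ (S k).card ≤ r) ∧
    (∀ k, G k ∈ Matrix.unitaryGroup (Config d L) ℂ ∧ ActsOn (S k) (G k)) ∧
    M = (List.ofFn G).prod

/-- A local unitary circuit of depth (at most) `D` with gates of range at most `r`: a product of
`D` layers, each of which may be trivial. -/
def IsLocalCircuit (D r : ℕ) (U : Op d L) : Prop :=
  ∃ layer : Fin D → Op d L,
    (∀ k, IsLocalLayer r (layer k)) ∧ U = (List.ofFn layer).prod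

/-- `Φ = |a⟩ ⊗ |b⟩` with normalized states `|a⟩` of the region `A` and `|b⟩` of its complement. -/
def IsBipartiteProduct (A : Finset (Fin L)) (Φ : Ket d L) : Prop :=
  ∃ (a : EuclideanSpace ℂ (A → Fin d)) (b : EuclideanSpace ℂ ((Aᶜ : Finset (Fin L)) → Fin d)),
    ‖a‖ = 1 ∧ ‖b‖ = 1 ∧ ∀ σ : Config d L, Φ σ = a (A.restrict σ) * b (Aᶜ.restrict σ)

/-- `Φ = |φ₁⟩ ⊗ ⋯ ⊗ |φ_L⟩` with normalized states `|φᵢ⟩` of the single sites. -/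
def IsProductState (Φ : Ket d L) : Prop :=
  ∃ φ : Fin L → EuclideanSpace ℂ (Fin d),
    (∀ i, ‖φ i‖ = 1) ∧ ∀ σ : Config d L, Φ σ = ∏ i, φ i (σ i)

/-- `Ψ = U |A⟩|B⟩`, with `B` the complement of `A` and `U` a local unitary circuit of depth `D` and
range `r`. -/
def IsCircuitOfBipartiteProduct (D r : ℕ) (A : Finset (Fin L)) (Ψ : Ket d L) : Prop :=
  ∃ (U : Op d L) (Φ : Ket d L), IsLocalCircuit D r U ∧ IsBipartiteProduct A Φ ∧
    Ψ.ofLp = U *ᵥ Φ.ofLp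

/-- `Ψ` is prepared from a product state by a local unitary circuit of depth `D` and range `r`. -/
def IsCircuitOfProductState (D r : ℕ) (Ψ : Ket d L) : Prop :=
  ∃ (V : Op d L) (Φ : Ket d L), IsLocalCircuit D r V ∧ IsProductState Φ ∧
    Ψ.ofLp = V *ᵥ Φ.ofLp

/-- The density matrices that are mixtures of pure states `U |A⟩|B⟩`; the circuit `U` of depth `D`
and range `r` and the division of the ring into two nonempty contiguous regions `A | B` may differ
from one pure state of the mixture to another. -/
def shortRangeBipartiteMixtures (d L D r : ℕ) : Set (Op d L) :=
  convexHull ℝ {ρ | ∃ (A : Finset (Fin L)) (Ψ : Ket d L), IsArc A ∧ A.Nonempty ∧ Aᶜ.Nonempty ∧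
    IsCircuitOfBipartiteProduct D r A Ψ ∧ ρ = ketBra Ψ}

end TranslationMMIS

end

/-!
The gates of a circuit of depth `D` and range `r` that lie in the light cone of a cut act within
distance `w = 1 + D r` of it. If `Ψ = U |A⟩|B⟩`, undoing these gates at the two ends of `A` hence
leaves a state that is a product across `A`: two unitaries `C` and `C'`, each within distance `w` of
one end, disentangle `A`. If `Ψ` is translation invariant, the translates of `C` and `C'` by `s`
disentangle the translate of `A`. The regions across which a state is a product are closed under
intersections and complements, so the part of `A` outside of its translate, an interval of length
`s` at the left end of `A`, is disentangled by `C` and its translate by `s` alone. A layer of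
translates of `C` around the ring therefore turns `Ψ` into a product of states of short intervals,
and one more layer turns it into a product of single-site states.

If the zero-momentum state were a mixture of states `U |A⟩|B⟩`, these would lie in its range, so
they would be translation invariant. Each of them is a product across some short interval up to
unitaries near its ends, hence annihilated by a nonzero operator `u` on a number `m` of consecutive
sites that depends only on `D` and `r`. With `d ^ m = n + 1`, a nonzero row of `u` expresses one of
the `n + 1` configurations of a block of `m` sites through the other `n`. On `N = L / m` disjoint
blocks the coefficients of this reduction depend on `u`, but only through the joint type of the
given and the reduced word. As there are only polynomially many joint types, all such states
together, for all `u`, span a space of dimension at most `poly(N) (n / (n + 1)) ^ N d ^ L`. For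
large `L` this is less than `d ^ L / L`, a lower bound for the rank of the projector onto zero
momentum.
-/

noncomputable section

open scoped Kronecker

namespace TranslationMMIS

/-! ### Operators on a region -/

theorem restrict_eq_restrict_iff {ι α : Type*} (S : Finset ι) (σ τ : ι → α) :
    S.restrict σ = S.restrict τ ↔ ∀ i ∈ S, σ i = τ i := by
  simp only [funext_iff, Finset.restrict, Subtype.forall]

section LocalOp

variable {ι α R : Type*} [Fintype ι] [DecidableEq ι]

/-- A configuration of all sites is a configuration of the region `S` together with one of its
complement. -/
def splitEquiv (α : Type*) (S : Finset ι) :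
    (ι → α) ≃ (S → α) × ((Sᶜ : Finset ι) → α) where
  toFun σ := (S.restrict σ, Sᶜ.restrict σ)
  invFun p i := if h : i ∈ S then p.1 ⟨i, h⟩ else p.2 ⟨i, Finset.mem_compl.2 h⟩
  left_inv σ := by ext i; by_cases h : i ∈ S <;> simp [h]
  right_inv p := by
    ext i
    · simp
    · simp [Finset.mem_compl.1 i.2]

theorem splitEquiv_apply (S : Finset ι) (σ : ι → α) :
    splitEquiv α S σ = (S.restrict σ, Sᶜ.restrict σ) := rfl

@[simp]
theorem restrict_splitEquiv_symm (S : Finset ι) (p : (S → α) × ((Sᶜ : Finset ι) → α)) :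
    S.restrict ((splitEquiv α S).symm p) = p.1 :=
  congrArg Prod.fst ((splitEquiv α S).apply_symm_apply p)

@[simp]
theorem restrict_compl_splitEquiv_symm (S : Finset ι) (p : (S → α) × ((Sᶜ : Finset ι) → α)) :
    Sᶜ.restrict ((splitEquiv α S).symm p) = p.2 :=
  congrArg Prod.snd ((splitEquiv α S).apply_symm_apply p)

theorem splitEquiv_symm_restrict (S : Finset ι) (σ τ : ι → α) :
    (splitEquiv α S).symm (S.restrict σ, Sᶜ.restrict τ) = S.piecewise σ τ := by
  ext i; by_cases h : i ∈ S <;> simp [splitEquiv, h]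

theorem sum_splitEquiv [Fintype α] [AddCommMonoid R] (S : Finset ι) (f : (ι → α) → R) :
    ∑ σ, f σ = ∑ b, ∑ a, f ((splitEquiv α S).symm (a, b)) := by
  rw [← (splitEquiv α S).symm.sum_comp, Fintype.sum_prod_type_right]

variable [DecidableEq α]

/-- The operator `u ⊗ 1`, with `u` acting on the sites in `S`. -/
def localOp [MulZeroOneClass R] (S : Finset ι) (u : Matrix (S → α) (S → α) R) :
    Matrix (ι → α) (ι → α) R :=
  (u ⊗ₖ (1 : Matrix ((Sᶜ : Finset ι) → α) _ R)).submatrix (splitEquiv α S) (splitEquiv α S)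

theorem localOp_apply [MulZeroOneClass R] (S : Finset ι) (u : Matrix (S → α) (S → α) R)
    (σ τ : ι → α) [Decidable (∀ i ∉ S, σ i = τ i)] :
    localOp S u σ τ = if ∀ i ∉ S, σ i = τ i then u (S.restrict σ) (S.restrict τ) else 0 := by
  have h : Sᶜ.restrict σ = Sᶜ.restrict τ ↔ ∀ i ∉ S, σ i = τ i := by
    simp [restrict_eq_restrict_iff]
  simp only [localOp, Matrix.submatrix_apply, splitEquiv_apply, Matrix.kroneckerMap_apply,
    Matrix.one_apply, h]
  split_ifs <;> simp

theorem localOp_zero [MulZeroOneClass R] (S : Finset ι) :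
    localOp S (0 : Matrix (S → α) (S → α) R) = 0 := by
  ext; simp [localOp_apply]

theorem localOp_ne_zero [MulZeroOneClass R] [Nonempty α] {S : Finset ι}
    {u : Matrix (S → α) (S → α) R} (hu : u ≠ 0) : localOp S u ≠ 0 := by
  contrapose! hu
  ext a b
  let c : (Sᶜ : Finset ι) → α := fun _ => Classical.arbitrary α
  simpa [localOp, splitEquiv_apply] using
    congrFun₂ hu ((splitEquiv α S).symm (a, c)) ((splitEquiv α S).symm (b, c))

theorem localOp_one [MulZeroOneClass R] (S : Finset ι) :
    localOp S (1 : Matrix (S → α) (S → α) R) = 1 := by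
  simp [localOp]

theorem localOp_mul [Fintype α] [CommSemiring R] (S : Finset ι) (u v : Matrix (S → α) (S → α) R) :
    localOp S (u * v) = localOp S u * localOp S v := by
  rw [localOp, localOp, localOp, Matrix.submatrix_mul_equiv, ← Matrix.mul_kronecker_mul, mul_one]

theorem localOp_conjTranspose [CommSemiring R] [StarRing R] (S : Finset ι)
    (u : Matrix (S → α) (S → α) R) : localOp S uᴴ = (localOp S u)ᴴ := by
  simp [localOp, Matrix.conjTranspose_submatrix, Matrix.conjTranspose_kronecker]

theorem localOp_mem_unitaryGroup [Fintype α] [CommRing R] [StarRing R] {S : Finset ι}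
    {u : Matrix (S → α) (S → α) R} (hu : u ∈ Matrix.unitaryGroup (S → α) R) :
    localOp S u ∈ Matrix.unitaryGroup (ι → α) R := by
  rw [Matrix.mem_unitaryGroup_iff, Matrix.star_eq_conjTranspose] at *
  rw [← localOp_conjTranspose, ← localOp_mul, hu, localOp_one]

theorem localOp_mulVec [Fintype α] [NonAssocSemiring R] (S : Finset ι)
    (u : Matrix (S → α) (S → α) R) (Φ : (ι → α) → R) (σ : ι → α) :
    (localOp S u *ᵥ Φ) σ =
      ∑ a, u (S.restrict σ) a * Φ ((splitEquiv α S).symm (a, Sᶜ.restrict σ)) := by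
  rw [Matrix.mulVec, dotProduct, sum_splitEquiv S, Finset.sum_eq_single (Sᶜ.restrict σ)]
  · simp [localOp, splitEquiv_apply]
  · intro b _ hb
    simp [localOp, splitEquiv_apply, hb.symm]
  · simp

end LocalOp

section ActsOn

variable {d L : ℕ} {S S' : Finset (Fin L)} {M N : Op d L}

theorem actsOn_iff_exists_localOp : ActsOn S M ↔ ∃ u, M = localOp S u :=
  exists_congr fun u => ⟨fun hu => by ext σ τ; rw [hu, localOp_apply],
    by rintro rfl; exact fun σ τ => localOp_apply S u σ τ⟩

theorem actsOn_localOp (S : Finset (Fin L)) (u : Matrix (S → Fin d) (S → Fin d) ℂ) :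
    ActsOn S (localOp S u) := ⟨u, fun σ τ => localOp_apply S u σ τ⟩

theorem ActsOn.one (S : Finset (Fin L)) : ActsOn S (1 : Op d L) :=
  localOp_one (α := Fin d) (R := ℂ) S ▸ actsOn_localOp S 1

theorem ActsOn.mul (hM : ActsOn S M) (hN : ActsOn S N) : ActsOn S (M * N) := by
  obtain ⟨u, rfl⟩ := actsOn_iff_exists_localOp.1 hM
  obtain ⟨v, rfl⟩ := actsOn_iff_exists_localOp.1 hN
  exact localOp_mul S u v ▸ actsOn_localOp S _

theorem ActsOn.conjTranspose (hM : ActsOn S M) : ActsOn S Mᴴ := by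
  obtain ⟨u, rfl⟩ := actsOn_iff_exists_localOp.1 hM
  exact localOp_conjTranspose S u ▸ actsOn_localOp S _

theorem ActsOn.mono (hM : ActsOn S M) (h : S ⊆ S') : ActsOn S' M := by
  obtain ⟨u, hu⟩ := hM
  refine ⟨fun a b => if ∀ i : S', i.1 ∉ S → a i = b i then
    u (fun i => a ⟨i, h i.2⟩) (fun i => b ⟨i, h i.2⟩) else 0, fun σ τ => ?_⟩
  have agree_iff : (∀ i ∉ S, σ i = τ i) ↔
      (∀ i ∉ S', σ i = τ i) ∧ ∀ i : S', i.1 ∉ S → S'.restrict σ i = S'.restrict τ i := by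
    refine ⟨fun hS => ⟨fun i hi => hS i (mt (@h i) hi), fun i hi => hS i hi⟩, fun hS i hi => ?_⟩
    by_cases hi' : i ∈ S'
    · exact hS.2 ⟨i, hi'⟩ hi
    · exact hS.1 i hi'
  rw [hu, if_congr agree_iff rfl rfl, ite_and]
  rfl

theorem ActsOn.eq_one_kronecker (hM : ActsOn Sᶜ M) :
    ∃ v : Matrix ((Sᶜ : Finset (Fin L)) → Fin d) _ ℂ, M =
      ((1 : Matrix (S → Fin d) _ ℂ) ⊗ₖ v).submatrix (splitEquiv (Fin d) S)
        (splitEquiv (Fin d) S) := by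
  obtain ⟨v, hv⟩ := hM
  refine ⟨v, ?_⟩
  ext σ τ
  have h : S.restrict σ = S.restrict τ ↔ ∀ i ∉ Sᶜ, σ i = τ i := by
    simp [restrict_eq_restrict_iff]
  simp only [hv, Matrix.submatrix_apply, splitEquiv_apply, Matrix.kroneckerMap_apply,
    Matrix.one_apply, h]
  split_ifs <;> simp

theorem ActsOn.commute (hM : ActsOn S M) (hN : ActsOn S' N) (h : Disjoint S S') :
    Commute M N := by
  obtain ⟨u, rfl⟩ := actsOn_iff_exists_localOp.1 hM
  obtain ⟨v, rfl⟩ := (hN.mono (Finset.subset_compl_iff_disjoint_left.2 h)).eq_one_kronecker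
  rw [Commute, SemiconjBy, localOp, Matrix.submatrix_mul_equiv, Matrix.submatrix_mul_equiv,
    ← Matrix.mul_kronecker_mul, ← Matrix.mul_kronecker_mul]
  simp only [mul_one, one_mul]

end ActsOn

/-! ### States that factorize -/

section Factorizes

variable {ι α K : Type*} [Fintype ι] [DecidableEq ι] [Field K] {A B : Finset ι} {Φ : (ι → α) → K}

/-- `Φ` is a product of a state of `A` and a state of its complement. -/
def Factorizes (A : Finset ι) (Φ : (ι → α) → K) : Prop :=
  ∃ (a : (A → α) → K) (b : ((Aᶜ : Finset ι) → α) → K),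
    ∀ σ, Φ σ = a (A.restrict σ) * b (Aᶜ.restrict σ)

theorem Factorizes.mul_eq_piecewise_mul_piecewise (h : Factorizes A Φ) (σ τ : ι → α) :
    Φ σ * Φ τ = Φ (A.piecewise σ τ) * Φ (A.piecewise τ σ) := by
  obtain ⟨a, b, h⟩ := h
  simp only [h, ← splitEquiv_symm_restrict, restrict_splitEquiv_symm,
    restrict_compl_splitEquiv_symm]
  ring

theorem factorizes_of_mul_eq_piecewise {ω : ι → α} (hω : Φ ω ≠ 0)
    (h : ∀ σ, Φ σ * Φ ω = Φ (A.piecewise σ ω) * Φ (A.piecewise ω σ)) : Factorizes A Φ := by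
  refine ⟨fun x => Φ ((splitEquiv α A).symm (x, Aᶜ.restrict ω)),
    fun y => Φ ((splitEquiv α A).symm (A.restrict ω, y)) / Φ ω, fun σ => ?_⟩
  dsimp only
  rw [splitEquiv_symm_restrict, splitEquiv_symm_restrict, ← mul_div_assoc, ← h,
    mul_div_cancel_right₀ _ hω]

theorem factorizes_zero (A : Finset ι) : Factorizes A (0 : (ι → α) → K) :=
  ⟨0, 0, by simp⟩

theorem Factorizes.compl (h : Factorizes A Φ) : Factorizes Aᶜ Φ := by
  by_cases h0 : Φ = 0
  · exact h0 ▸ factorizes_zero _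
  obtain ⟨ω, hω⟩ := Function.ne_iff.1 h0
  refine factorizes_of_mul_eq_piecewise hω fun σ => ?_
  rw [Finset.piecewise_compl, Finset.piecewise_compl, h.mul_eq_piecewise_mul_piecewise, mul_comm]

theorem Factorizes.smul (h : Factorizes A Φ) (c : K) : Factorizes A (c • Φ) := by
  obtain ⟨a, b, h⟩ := h
  exact ⟨c • a, b, fun σ => by simp [h, mul_assoc]⟩

theorem Factorizes.inter (hA : Factorizes A Φ) (hB : Factorizes B Φ) : Factorizes (A ∩ B) Φ := by
  by_cases h0 : Φ = 0
  · exact h0 ▸ factorizes_zero _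
  obtain ⟨ω, hω⟩ := Function.ne_iff.1 h0
  refine factorizes_of_mul_eq_piecewise hω fun σ => mul_right_cancel₀ hω ?_
  have cut_A := hA.mul_eq_piecewise_mul_piecewise σ ω
  have cut_B := hB.mul_eq_piecewise_mul_piecewise (A.piecewise σ ω) ω
  have glue := hA.mul_eq_piecewise_mul_piecewise ((A ∩ B).piecewise ω σ) ω
  have e₁ : B.piecewise (A.piecewise σ ω) ω = (A ∩ B).piecewise σ ω := by
    ext i; by_cases hA : i ∈ A <;> by_cases hB : i ∈ B <;> simp [Finset.piecewise, hA, hB]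
  have e₂ : B.piecewise ω (A.piecewise σ ω) = A.piecewise ((A ∩ B).piecewise ω σ) ω := by
    ext i; by_cases hA : i ∈ A <;> by_cases hB : i ∈ B <;> simp [Finset.piecewise, hA, hB]
  have e₃ : A.piecewise ω ((A ∩ B).piecewise ω σ) = A.piecewise ω σ := by
    ext i; by_cases hA : i ∈ A <;> by_cases hB : i ∈ B <;> simp [Finset.piecewise, hA, hB]
  rw [e₁, e₂] at cut_B
  rw [e₃] at glue
  linear_combination
    Φ ω * cut_A + Φ (A.piecewise ω σ) * cut_B - Φ ((A ∩ B).piecewise σ ω) * glue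

variable [Fintype α] [DecidableEq α]

theorem localOp_mulVec_of_eq_mul {a : (A → α) → K} {b : ((Aᶜ : Finset ι) → α) → K}
    (h : ∀ σ, Φ σ = a (A.restrict σ) * b (Aᶜ.restrict σ)) (u : Matrix (A → α) (A → α) K)
    (σ : ι → α) :
    (localOp A u *ᵥ Φ) σ = (u *ᵥ a) (A.restrict σ) * b (Aᶜ.restrict σ) := by
  rw [localOp_mulVec]
  simp [h, Matrix.mulVec, dotProduct, Finset.sum_mul, mul_assoc]

theorem Factorizes.localOp_mulVec (h : Factorizes A Φ) (u : Matrix (A → α) (A → α) K) :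
    Factorizes A (localOp A u *ᵥ Φ) := by
  obtain ⟨a, b, h⟩ := h
  exact ⟨u *ᵥ a, b, localOp_mulVec_of_eq_mul h u⟩

theorem Factorizes.exists_localOp_mulVec_eq_zero [Nontrivial (A → α)] (h : Factorizes A Φ) :
    ∃ u : Matrix (A → α) (A → α) K, u ≠ 0 ∧ localOp A u *ᵥ Φ = 0 := by
  obtain ⟨a, b, h⟩ := h
  have not_injective : ¬ Function.Injective (Fintype.linearCombination K a) := fun hi => by
    have := LinearMap.finrank_le_finrank_of_injective hi
    rw [Module.finrank_fintype_fun_eq_card, Module.finrank_self] at this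
    exact this.not_gt Fintype.one_lt_card
  obtain ⟨q, hq, hq0⟩ := (Submodule.ne_bot_iff _).1 (mt LinearMap.ker_eq_bot.1 not_injective)
  refine ⟨Matrix.of fun _ => q, fun hu => hq0 ?_, funext fun σ => ?_⟩
  · obtain ⟨x⟩ := (inferInstance : Nonempty (A → α))
    exact congrFun hu x
  · have orthogonal : q ⬝ᵥ a = 0 := by
      simpa [Fintype.linearCombination_apply, dotProduct] using hq
    rw [localOp_mulVec_of_eq_mul h]
    simp [Matrix.mulVec, orthogonal]

end Factorizes

section ActsOnFactorizes

variable {d L : ℕ} {A : Finset (Fin L)} {Φ : Config d L → ℂ} {M : Op d L}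

theorem Factorizes.mulVec (h : Factorizes A Φ) (hM : ActsOn A M) : Factorizes A (M *ᵥ Φ) := by
  obtain ⟨u, rfl⟩ := actsOn_iff_exists_localOp.1 hM
  exact h.localOp_mulVec u

theorem Factorizes.mulVec_of_compl (h : Factorizes A Φ) (hM : ActsOn Aᶜ M) :
    Factorizes A (M *ᵥ Φ) := by
  simpa using (h.compl.mulVec hM).compl

theorem IsBipartiteProduct.factorizes {Φ : Ket d L} (h : IsBipartiteProduct A Φ) :
    Factorizes A Φ.ofLp := by
  obtain ⟨a, b, -, -, h⟩ := h
  exact ⟨a, b, h⟩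

theorem IsBipartiteProduct.norm_eq_one {Φ : Ket d L} (h : IsBipartiteProduct A Φ) : ‖Φ‖ = 1 := by
  obtain ⟨a, b, ha, hb, h⟩ := h
  rw [← sq_eq_sq₀ (norm_nonneg _) zero_le_one, one_pow, EuclideanSpace.norm_sq_eq,
    sum_splitEquiv A]
  simp only [h, norm_mul, mul_pow, restrict_splitEquiv_symm, restrict_compl_splitEquiv_symm,
    ← Finset.sum_mul, ← Finset.mul_sum, ← EuclideanSpace.norm_sq_eq, ha, hb]
  norm_num

end ActsOnFactorizes

/-! ### Unitary matrices -/

section Unitary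

variable {n 𝕜 : Type*} [Fintype n] [DecidableEq n] [RCLike 𝕜]

theorem norm_toLp_mulVec {M : Matrix n n 𝕜} (hM : M ∈ Matrix.unitaryGroup n 𝕜) (x : n → 𝕜) :
    ‖WithLp.toLp 2 (M *ᵥ x)‖ = ‖WithLp.toLp 2 x‖ := by
  rw [norm_eq_sqrt_re_inner (𝕜 := 𝕜), norm_eq_sqrt_re_inner (𝕜 := 𝕜),
    EuclideanSpace.inner_toLp_toLp, EuclideanSpace.inner_toLp_toLp, Matrix.star_mulVec,
    dotProduct_comm, Matrix.dotProduct_mulVec, Matrix.vecMul_vecMul,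
    ← Matrix.star_eq_conjTranspose, Matrix.mem_unitaryGroup_iff'.1 hM, Matrix.vecMul_one,
    dotProduct_comm]

theorem exists_mem_unitaryGroup_mulVec_eq_single (i : n) (v : n → 𝕜) :
    ∃ u ∈ Matrix.unitaryGroup n 𝕜, ∃ c, u *ᵥ v = Pi.single i c := by
  by_cases hv : v = 0
  · exact ⟨1, one_mem _, 0, by simp [hv]⟩
  let w : EuclideanSpace 𝕜 n := WithLp.toLp 2 v
  have hw : ‖w‖ ≠ 0 := norm_ne_zero_iff.2 (by simpa [w] using hv)
  have orthonormal_w : Orthonormal 𝕜 (({i} : Set n).domRestrict fun _ => (‖w‖⁻¹ : 𝕜) • w) :=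
    ⟨fun _ => by simp [norm_smul, hw],
      fun j k hjk => absurd (Subtype.ext (j.2.trans k.2.symm)) hjk⟩
  obtain ⟨b, hb⟩ := orthonormal_w.exists_orthonormalBasis_extension_of_card_eq (by simp)
  obtain ⟨c, w_eq⟩ : ∃ c : 𝕜, w = c • b i :=
    ⟨‖w‖, by rw [hb i rfl, smul_smul, mul_inv_cancel₀ (by exact_mod_cast hw), one_smul]⟩
  refine ⟨_, b.toMatrix_orthonormalBasis_mem_unitary (EuclideanSpace.basisFun n 𝕜), c, ?_⟩
  have repr_w : b.toBasis.toMatrix (EuclideanSpace.basisFun n 𝕜).toBasis *ᵥ v = b.toBasis.repr w :=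
    (EuclideanSpace.basisFun n 𝕜).toBasis.toMatrix_mulVec_repr b.toBasis w
  ext j
  rw [← OrthonormalBasis.coe_toBasis, repr_w, w_eq, map_smul]
  simp [Pi.single_apply, eq_comm]

end Unitary

/-! ### Translations -/

section Relabel

variable {ι α R : Type*} [Fintype ι] [DecidableEq ι]

theorem Factorizes.map {K : Type*} [Field K] {A : Finset ι} {Φ : (ι → α) → K}
    (h : Factorizes A Φ) (e : Equiv.Perm ι) :
    Factorizes (A.map e.toEmbedding) fun σ => Φ (σ ∘ e) := by
  obtain ⟨a, b, h⟩ := h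
  have mem_map (i : A) : e i ∈ A.map e.toEmbedding := by simp
  have mem_compl_map (i : (Aᶜ : Finset ι)) : e i ∈ (A.map e.toEmbedding)ᶜ := by
    simpa using Finset.mem_compl.1 i.2
  exact ⟨fun x => a fun i => x ⟨e i, mem_map i⟩, fun y => b fun i => y ⟨e i, mem_compl_map i⟩,
    fun σ => h (σ ∘ e)⟩

variable [Fintype α] [DecidableEq α] [CommRing R]

/-- The operator `M` with its sites moved by the permutation `e`. -/
def relabel (e : Equiv.Perm ι) : Matrix (ι → α) (ι → α) R ≃ₐ[R] Matrix (ι → α) (ι → α) R :=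
  Matrix.reindexAlgEquiv R R (e.arrowCongr (Equiv.refl α))

theorem relabel_apply (e : Equiv.Perm ι) (M : Matrix (ι → α) (ι → α) R) (σ τ : ι → α) :
    relabel e M σ τ = M (σ ∘ e) (τ ∘ e) := rfl

theorem relabel_pow_add (e : Equiv.Perm ι) (k l : ℕ) (M : Matrix (ι → α) (ι → α) R) :
    relabel (e ^ (k + l)) M = relabel (e ^ k) (relabel (e ^ l) M) := by
  rw [pow_add]
  rfl

theorem relabel_mem_unitaryGroup [StarRing R] (e : Equiv.Perm ι) {M : Matrix (ι → α) (ι → α) R}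
    (hM : M ∈ Matrix.unitaryGroup (ι → α) R) : relabel e M ∈ Matrix.unitaryGroup (ι → α) R := by
  rw [Matrix.mem_unitaryGroup_iff] at *
  rw [show star (relabel e M) = relabel e (star M) from rfl, ← map_mul, hM, map_one]

theorem relabel_mulVec (e : Equiv.Perm ι) (M : Matrix (ι → α) (ι → α) R) (Φ : (ι → α) → R) :
    relabel e M *ᵥ (fun σ => Φ (σ ∘ e)) = fun σ => (M *ᵥ Φ) (σ ∘ e) :=
  funext fun _ => Fintype.sum_equiv (e.arrowCongr (Equiv.refl α)).symm _ _ fun _ => rfl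

end Relabel

section Translation

variable {d L : ℕ}

theorem ActsOn.map {S : Finset (Fin L)} {M : Op d L} (h : ActsOn S M)
    (e : Equiv.Perm (Fin L)) : ActsOn (S.map e.toEmbedding) (relabel e M) := by
  obtain ⟨u, hu⟩ := h
  have mem_map (i : S) : e i ∈ S.map e.toEmbedding := by simp
  refine ⟨u.submatrix (fun a i => a ⟨e i, mem_map i⟩) (fun a i => a ⟨e i, mem_map i⟩),
    fun σ τ => ?_⟩
  have agree_iff : (∀ i ∉ S, σ (e i) = τ (e i)) ↔ ∀ i ∉ S.map e.toEmbedding, σ i = τ i := by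
    rw [← e.forall_congr_right (q := fun i => i ∉ S.map e.toEmbedding → σ i = τ i)]
    simp
  simp only [relabel_apply, hu, Function.comp_apply, agree_iff]
  rfl

theorem translation_mulVec (Φ : Config d L → ℂ) :
    translation d L *ᵥ Φ = fun σ => Φ (σ ∘ finRotate L) := by
  ext σ
  simp [Matrix.mulVec, dotProduct, translation]

theorem translation_pow_mulVec (n : ℕ) (Φ : Config d L → ℂ) :
    translation d L ^ n *ᵥ Φ = fun σ => Φ (σ ∘ ⇑(finRotate L ^ n)) := by
  induction n with
  | zero => simp
  | succ n ih =>
    rw [pow_succ', ← Matrix.mulVec_mulVec, ih, translation_mulVec, pow_succ']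
    rfl

theorem IsTranslationSymmetric.exists_comp_finRotate_pow_eq_smul {Ψ : Ket d L}
    (h : IsTranslationSymmetric Ψ) (n : ℕ) :
    ∃ c : ℂ, c ≠ 0 ∧ (fun σ => Ψ.ofLp (σ ∘ ⇑(finRotate L ^ n))) = c • Ψ.ofLp := by
  by_cases h0 : Ψ.ofLp = 0
  · exact ⟨1, one_ne_zero, by ext σ; simp [h0]⟩
  obtain ⟨c, hc⟩ := h
  have c_ne_zero : c ≠ 0 := by
    rintro rfl
    rw [translation_mulVec, zero_smul] at hc
    exact h0 <| funext fun σ => by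
      simpa [Function.comp_assoc] using congrFun hc (σ ∘ (finRotate L).symm)
  refine ⟨c ^ n, pow_ne_zero n c_ne_zero, ?_⟩
  rw [← translation_pow_mulVec]
  induction n with
  | zero => simp
  | succ n ih =>
    rw [pow_succ' (translation d L), ← Matrix.mulVec_mulVec, ih, Matrix.mulVec_smul, hc, smul_smul,
      ← pow_succ]

theorem IsTranslationSymmetric.exists_relabel_mulVec {Ψ : Ket d L} (h : IsTranslationSymmetric Ψ)
    (k : ℕ) (M : Op d L) :
    ∃ c : ℂ, relabel (finRotate L ^ k) M *ᵥ Ψ.ofLp =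
      c • fun σ => (M *ᵥ Ψ.ofLp) (σ ∘ ⇑(finRotate L ^ k)) := by
  obtain ⟨c, hc, hk⟩ := h.exists_comp_finRotate_pow_eq_smul k
  refine ⟨c⁻¹, ?_⟩
  rw [← relabel_mulVec, hk, Matrix.mulVec_smul, inv_smul_smul₀ hc]

theorem val_finRotate_pow (k : ℕ) (i : Fin L) : ((finRotate L ^ k) i : ℕ) = (i + k) % L := by
  induction k with
  | zero => simp [Nat.mod_eq_of_lt i.2]
  | succ k ih =>
    have := i.neZero
    rw [pow_succ', Equiv.Perm.mul_apply, finRotate_apply, Fin.val_add, ih]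
    simp [← add_assoc]

theorem finRotate_pow_self (L : ℕ) : finRotate L ^ L = 1 := by
  ext i
  simp [val_finRotate_pow, Nat.mod_eq_of_lt i.2]

end Translation

/-! ### Contiguous regions of the ring -/

section Seg

variable {L : ℕ} {a b : ℤ} {m n : ℕ}

open scoped Classical in
/-- The region `a, a + 1, …, a + n - 1` of the ring, where `a` is an integer position mod `L`. -/
def seg (L : ℕ) (a : ℤ) (n : ℕ) : Finset (Fin L) :=
  Finset.univ.filter fun i => ∃ k : ℤ, a ≤ i + k * L ∧ i + k * L < a + n

theorem mem_seg {i : Fin L} : i ∈ seg L a n ↔ ∃ k : ℤ, a ≤ i + k * L ∧ i + k * L < a + n := by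
  simp [seg]

theorem exists_add_mul_eq (hL : 0 < L) (z : ℤ) : ∃ (i : Fin L) (k : ℤ), (i : ℤ) + k * L = z := by
  have hL' : (0 : ℤ) < L := by omega
  have mod_nonneg := Int.emod_nonneg z hL'.ne'
  have mod_lt := Int.emod_lt_of_pos z hL'
  refine ⟨⟨(z % L).toNat, by omega⟩, z / L, ?_⟩
  simpa only [Int.toNat_of_nonneg mod_nonneg] using Int.emod_add_ediv_mul z L

theorem exists_mem_Ico_add_mul (hL : 0 < L) (a z : ℤ) :
    ∃ k : ℤ, a ≤ z + k * L ∧ z + k * L < a + L := by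
  have hL' : (0 : ℤ) < L := by omega
  have div_add_mod := Int.emod_add_ediv_mul (z - a) L
  have mod_nonneg := Int.emod_nonneg (z - a) hL'.ne'
  have mod_lt := Int.emod_lt_of_pos (z - a) hL'
  exact ⟨-((z - a) / L), by linarith, by linarith⟩

theorem seg_subset (h₁ : b ≤ a) (h₂ : a + n ≤ b + m) : seg L a n ⊆ seg L b m := fun i hi => by
  obtain ⟨k, hk⟩ := mem_seg.1 hi
  exact mem_seg.2 ⟨k, by omega, by omega⟩

theorem seg_nonempty (hL : 0 < L) (a : ℤ) (hn : 0 < n) : (seg L a n).Nonempty := by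
  obtain ⟨i, k, hk⟩ := exists_add_mul_eq hL a
  exact ⟨i, mem_seg.2 ⟨k, by omega, by omega⟩⟩

theorem seg_add_int_mul (a j : ℤ) (n : ℕ) : seg L (a + j * L) n = seg L a n := by
  ext i
  simp only [mem_seg]
  constructor
  · rintro ⟨k, hk⟩
    exact ⟨k - j, by linarith, by linarith⟩
  · rintro ⟨k, hk⟩
    exact ⟨k + j, by linarith, by linarith⟩

theorem seg_add_period (a : ℤ) (n : ℕ) : seg L (a + L) n = seg L a n := by
  simpa using seg_add_int_mul (L := L) a 1 n

theorem seg_disjoint (h₁ : a + n ≤ b) (h₂ : b + m ≤ a + L) :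
    Disjoint (seg L a n) (seg L b m) := by
  rw [Finset.disjoint_left]
  intro i ha hb
  obtain ⟨k, hk⟩ := mem_seg.1 ha
  obtain ⟨l, hl⟩ := mem_seg.1 hb
  have hL : (0 : ℤ) < L := by have := i.pos; omega
  have k_lt : k < l := lt_of_mul_lt_mul_right (by linarith) hL.le
  have lt_succ : l < k + 1 := lt_of_mul_lt_mul_right (by linarith) hL.le
  omega

theorem compl_seg (hn : n ≤ L) : (seg L a n)ᶜ = seg L (a + n) (L - n) := by
  refine subset_antisymm (fun i hi => ?_)
    (Finset.subset_compl_iff_disjoint_left.2 (seg_disjoint le_rfl (by omega)))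
  obtain ⟨k, hk⟩ := exists_mem_Ico_add_mul i.pos a i
  have le_position := not_lt.1 fun h => Finset.mem_compl.1 hi (mem_seg.2 ⟨k, hk.1, h⟩)
  exact mem_seg.2 ⟨k, by omega, by omega⟩

theorem seg_inter_compl_seg (hm : m ≤ n) (hmn : m + n ≤ L) :
    seg L a n ∩ (seg L (a + m) n)ᶜ = seg L a m := by
  ext i
  rw [Finset.mem_inter, Finset.mem_compl]
  constructor
  · rintro ⟨hi, hi'⟩
    obtain ⟨k, hk⟩ := mem_seg.1 hi
    have position_lt := not_le.1 fun h => hi' (mem_seg.2 ⟨k, h, by omega⟩)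
    exact mem_seg.2 ⟨k, by omega, by omega⟩
  · intro hi
    exact ⟨seg_subset le_rfl (by omega) hi,
      Finset.disjoint_left.1 (seg_disjoint le_rfl (by omega)) hi⟩

theorem seg_subset_of_not_disjoint {r : ℕ} (hm : m ≤ r) (h : ¬Disjoint (seg L b m) (seg L a n)) :
    seg L b m ⊆ seg L (a - r) (n + 2 * r) := by
  obtain ⟨i, hb, ha⟩ := Finset.not_disjoint_iff.1 h
  obtain ⟨k, hk⟩ := mem_seg.1 hb
  obtain ⟨l, hl⟩ := mem_seg.1 ha
  rw [← seg_add_int_mul b (l - k)]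
  exact seg_subset (by linarith) (by push_cast; linarith)

theorem seg_subset_or_subset_compl (hn : n ≤ L)
    (ha : Disjoint (seg L b m) (seg L (a - 1) 2))
    (ha' : Disjoint (seg L b m) (seg L (a + n - 1) 2)) :
    seg L b m ⊆ seg L a n ∨ seg L b m ⊆ (seg L a n)ᶜ := by
  rcases Nat.eq_zero_or_pos L with rfl | hL
  · exact Or.inl fun i => i.elim0
  wlog hb : a ≤ b ∧ b < a + L generalizing b
  · obtain ⟨k, hk⟩ := exists_mem_Ico_add_mul hL a b
    rw [← seg_add_int_mul b k] at ha ha' ⊢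
    exact this ha ha' hk
  rcases Nat.eq_zero_or_pos m with rfl | _
  · refine Or.inl fun i hi => ?_
    obtain ⟨k, hk⟩ := mem_seg.1 hi
    omega
  rcases lt_or_ge b (a + n) with hbn | hbn
  · refine Or.inl (seg_subset hb.1 (not_lt.1 fun crosses => ?_))
    obtain ⟨i, k, hk⟩ := exists_add_mul_eq hL (a + n - 1)
    exact Finset.disjoint_left.1 ha' (mem_seg.2 ⟨k, by omega, by omega⟩ : i ∈ seg L b m)
      (mem_seg.2 ⟨k, by omega, by omega⟩)
  · rw [compl_seg hn]
    refine Or.inr (seg_subset hbn (not_lt.1 fun crosses => ?_))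
    obtain ⟨i, k, hk⟩ := exists_add_mul_eq hL (a + L - 1)
    exact Finset.disjoint_left.1 ha (mem_seg.2 ⟨k, by omega, by omega⟩ : i ∈ seg L b m)
      (mem_seg.2 ⟨k - 1, by linarith, by push_cast; linarith⟩)

theorem seg_map_finRotate_pow (a : ℤ) (n k : ℕ) :
    (seg L a n).map (finRotate L ^ k).toEmbedding = seg L (a + k) n := by
  ext i
  obtain ⟨j, rfl⟩ := (finRotate L ^ k).surjective i
  have div_add_mod := Int.emod_add_ediv_mul ((j : ℤ) + k) L
  simp only [Finset.mem_map_equiv, Equiv.symm_apply_apply, mem_seg, val_finRotate_pow]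
  push_cast
  constructor
  · rintro ⟨l, hl⟩
    exact ⟨l + ((j : ℤ) + k) / L, by linarith, by linarith⟩
  · rintro ⟨l, hl⟩
    exact ⟨l - ((j : ℤ) + k) / L, by linarith, by linarith⟩

theorem arc_eq_seg (i : Fin L) (n : ℕ) : arc i n = seg L i n := by
  ext j
  simp only [arc, Finset.mem_image, Finset.mem_range, mem_seg]
  constructor
  · rintro ⟨k, hk, rfl⟩
    have div_add_mod := Int.emod_add_ediv_mul ((i : ℤ) + k) L
    refine ⟨((i : ℤ) + k) / L, ?_⟩
    rw [val_finRotate_pow]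
    push_cast
    omega
  · rintro ⟨k, hk⟩
    refine ⟨((j : ℤ) + k * L - i).toNat, by omega, Fin.ext ?_⟩
    have lift_eq : ((i + ((j : ℤ) + k * L - i).toNat : ℕ) : ℤ) = j + k * L := by omega
    rw [val_finRotate_pow, ← Int.ofNat_inj, Int.natCast_mod, lift_eq, Int.add_mul_emod_self_right,
      Int.emod_eq_of_lt (by omega) (by have := j.2; omega)]

theorem card_arc {i : Fin L} (hn : n ≤ L) : (arc i n).card = n := by
  rw [arc, Finset.card_image_of_injOn, Finset.card_range]
  intro k hk l hl h
  have val_eq : (i + k) % L = (i + l) % L := by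
    rw [← val_finRotate_pow, ← val_finRotate_pow]
    exact congrArg Fin.val h
  exact (Nat.ModEq.add_left_cancel' (i : ℕ) val_eq).eq_of_lt_of_lt
    (by simp at hk; omega) (by simp at hl; omega)

theorem exists_seg_eq_arc (hL : 0 < L) (a : ℤ) : ∃ i : Fin L, ∀ n, seg L a n = arc i n := by
  obtain ⟨i, k, rfl⟩ := exists_add_mul_eq hL a
  exact ⟨i, fun n => by rw [arc_eq_seg, seg_add_int_mul]⟩

theorem card_seg (hL : 0 < L) (a : ℤ) (hn : n ≤ L) : (seg L a n).card = n := by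
  obtain ⟨i, hi⟩ := exists_seg_eq_arc hL a
  rw [hi, card_arc hn]

theorem card_seg_le (hL : 0 < L) (a : ℤ) (n : ℕ) : (seg L a n).card ≤ n := by
  obtain ⟨i, hi⟩ := exists_seg_eq_arc hL a
  rw [hi]
  exact Finset.card_image_le.trans_eq (Finset.card_range n)

theorem isArc_seg (hL : 0 < L) (a : ℤ) (n : ℕ) : IsArc (seg L a n) := by
  obtain ⟨i, hi⟩ := exists_seg_eq_arc hL a
  exact ⟨i, n, hi n⟩

theorem IsArc.exists_eq_seg {S : Finset (Fin L)} (h : IsArc S) :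
    0 < L ∧ ∃ (a : ℤ) (n : ℕ), n ≤ L ∧ S = seg L a n ∧ S.card = n := by
  obtain ⟨i, n, rfl⟩ := h
  refine ⟨i.pos, i, ?_⟩
  rcases le_total n L with hn | hn
  · exact ⟨n, hn, arc_eq_seg i n, card_arc hn⟩
  · have card_arc_L : (arc i L).card = L := card_arc le_rfl
    have arc_L : arc i L = Finset.univ := Finset.eq_univ_of_card _ (by simpa using card_arc_L)
    have arc_n : arc i n = arc i L := by
      rw [arc_L, ← Finset.univ_subset_iff, ← arc_L, arc_eq_seg, arc_eq_seg]
      exact seg_subset le_rfl (by omega)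
    exact ⟨L, le_rfl, by rw [arc_n, arc_eq_seg], by rw [arc_n, card_arc_L]⟩

theorem ActsOn.relabel_seg {d : ℕ} {M : Op d L} (h : ActsOn (seg L a n) M) (k : ℕ) :
    ActsOn (seg L (a + k) n) (relabel (finRotate L ^ k) M) :=
  seg_map_finRotate_pow a n k ▸ h.map _

end Seg

/-! ### Light cones of circuits -/

section Circuit

variable {d L D : ℕ} {𝒢 𝒢' : Set (Finset (Fin L))} {M U : Op d L}

/-- A layer of unitary gates on pairwise disjoint regions taken from the family `𝒢`. -/
def IsGateLayer (𝒢 : Set (Finset (Fin L))) (M : Op d L) : Prop :=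
  ∃ l : List (Finset (Fin L) × Op d L), l.Pairwise (fun g g' => Disjoint g.1 g'.1) ∧
    (∀ g ∈ l, g.1 ∈ 𝒢 ∧ g.2 ∈ Matrix.unitaryGroup (Config d L) ℂ ∧ ActsOn g.1 g.2) ∧
    M = (l.map Prod.snd).prod

/-- A circuit of `D` layers of unitary gates on regions taken from the family `𝒢`. -/
inductive IsGateCircuit (𝒢 : Set (Finset (Fin L))) : ℕ → Op d L → Prop
  | zero : IsGateCircuit 𝒢 0 1
  | succ {D : ℕ} {M U : Op d L} (hM : IsGateLayer 𝒢 M) (hU : IsGateCircuit 𝒢 D U) :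
      IsGateCircuit 𝒢 (D + 1) (M * U)

theorem IsLocalLayer.isGateLayer {r : ℕ} (h : IsLocalLayer r M) :
    IsGateLayer {S | IsArc S ∧ S.card ≤ r} M := by
  obtain ⟨n, S, G, hdisjoint, harc, hgate, rfl⟩ := h
  refine ⟨List.ofFn fun k => (S k, G k), List.pairwise_ofFn.2 fun j k hjk => hdisjoint j k hjk.ne,
    fun g hg => ?_, by rw [List.map_ofFn]; rfl⟩
  obtain ⟨k, rfl⟩ := List.mem_ofFn.1 hg
  exact ⟨harc k, hgate k⟩

theorem IsLocalCircuit.isGateCircuit {r : ℕ} (h : IsLocalCircuit D r U) :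
    IsGateCircuit {S | IsArc S ∧ S.card ≤ r} D U := by
  obtain ⟨layer, hlayer, rfl⟩ := h
  induction D with
  | zero => exact .zero
  | succ D ih =>
    rw [List.ofFn_succ, List.prod_cons]
    exact .succ (hlayer 0).isGateLayer (ih _ fun k => hlayer k.succ)

theorem IsGateLayer.mono (h : IsGateLayer 𝒢 M) (h𝒢 : 𝒢 ⊆ 𝒢') : IsGateLayer 𝒢' M := by
  obtain ⟨l, hdisjoint, hl, rfl⟩ := h
  exact ⟨l, hdisjoint, fun g hg => ⟨h𝒢 (hl g hg).1, (hl g hg).2⟩, rfl⟩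

theorem IsGateLayer.mem_unitaryGroup (h : IsGateLayer 𝒢 M) :
    M ∈ Matrix.unitaryGroup (Config d L) ℂ := by
  obtain ⟨l, -, hl, rfl⟩ := h
  exact Submonoid.list_prod_mem _ (List.forall_mem_map.2 fun g hg => (hl g hg).2.1)

theorem IsGateCircuit.mem_unitaryGroup (h : IsGateCircuit 𝒢 D U) :
    U ∈ Matrix.unitaryGroup (Config d L) ℂ := by
  induction h with
  | zero => exact one_mem _
  | succ hM _ ih => exact mul_mem hM.mem_unitaryGroup ih

theorem IsGateLayer.actsOn (h : IsGateLayer 𝒢 M) {Z : Finset (Fin L)} (hZ : ∀ S ∈ 𝒢, S ⊆ Z) :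
    ActsOn Z M := by
  obtain ⟨l, -, hl, rfl⟩ := h
  exact List.prod_induction (ActsOn Z) (fun _ _ => ActsOn.mul) (ActsOn.one Z)
    (List.forall_mem_map.2 fun g hg => (hl g hg).2.2.mono (hZ _ (hl g hg).1))

theorem IsGateLayer.factorizes_mulVec (h : IsGateLayer 𝒢 M) {A : Finset (Fin L)}
    (hA : ∀ S ∈ 𝒢, S ⊆ A ∨ S ⊆ Aᶜ) {Φ : Config d L → ℂ} (hΦ : Factorizes A Φ) :
    Factorizes A (M *ᵥ Φ) := by
  obtain ⟨l, -, hl, rfl⟩ := h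
  refine List.prod_induction (fun N : Op d L => ∀ Φ, Factorizes A Φ → Factorizes A (N *ᵥ Φ))
    (fun N N' hN hN' Φ hΦ => ?_) (fun Φ hΦ => by rwa [Matrix.one_mulVec])
    (List.forall_mem_map.2 fun g hg Φ hΦ => ?_) Φ hΦ
  · rw [← Matrix.mulVec_mulVec]
    exact hN _ (hN' _ hΦ)
  · obtain ⟨hmem, -, hacts⟩ := hl g hg
    exact (hA _ hmem).elim (fun hS => hΦ.mulVec (hacts.mono hS))
      fun hS => hΦ.mulVec_of_compl (hacts.mono hS)

theorem IsGateCircuit.factorizes_mulVec (h : IsGateCircuit 𝒢 D U) {A : Finset (Fin L)}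
    (hA : ∀ S ∈ 𝒢, S ⊆ A ∨ S ⊆ Aᶜ) {Φ : Config d L → ℂ} (hΦ : Factorizes A Φ) :
    Factorizes A (U *ᵥ Φ) := by
  induction h with
  | zero => rwa [Matrix.one_mulVec]
  | succ hM _ ih =>
    rw [← Matrix.mulVec_mulVec]
    exact hM.factorizes_mulVec hA ih

theorem IsGateLayer.exists_eq_mul (h : IsGateLayer 𝒢 M) {Z Z' : Finset (Fin L)}
    (hZ : ∀ S ∈ 𝒢, ¬Disjoint S Z → S ⊆ Z') :
    ∃ C R : Op d L, M = C * R ∧ C ∈ Matrix.unitaryGroup (Config d L) ℂ ∧ ActsOn Z' C ∧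
      IsGateLayer {S ∈ 𝒢 | Disjoint S Z} R := by
  obtain ⟨l, hdisjoint, hl, rfl⟩ := h
  let meetsZ : Finset (Fin L) × Op d L → Bool := fun g => !decide (Disjoint g.1 Z)
  have layer_meets : IsGateLayer {S ∈ 𝒢 | ¬Disjoint S Z} ((l.filter meetsZ).map Prod.snd).prod :=
    ⟨_, hdisjoint.filter _, fun g hg => by
      rw [List.mem_filter] at hg
      exact ⟨⟨(hl g hg.1).1, by simpa [meetsZ] using hg.2⟩, (hl g hg.1).2⟩, rfl⟩
  refine ⟨_, ((l.filter fun g => !meetsZ g).map Prod.snd).prod, ?_, layer_meets.mem_unitaryGroup,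
    layer_meets.actsOn fun S hS => hZ S hS.1 hS.2, _, hdisjoint.filter _, fun g hg => ?_, rfl⟩
  · rw [← List.prod_append, ← List.map_append]
    refine ((List.filter_append_perm meetsZ l).symm.map Prod.snd).prod_eq' ?_
    rw [List.pairwise_map]
    exact hdisjoint.imp_of_mem fun hg hg' hgg' => (hl _ hg).2.2.commute (hl _ hg').2.2 hgg'
  · rw [List.mem_filter] at hg
    exact ⟨⟨(hl g hg.1).1, by simpa [meetsZ] using hg.2⟩, (hl g hg.1).2⟩

theorem IsGateCircuit.exists_eq_mul (h : IsGateCircuit 𝒢 D U) {Z : ℕ → Finset (Fin L)}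
    (hmono : Monotone Z) (hZ : ∀ j, ∀ S ∈ 𝒢, ¬Disjoint S (Z j) → S ⊆ Z (j + 1)) :
    ∃ C R : Op d L, U = C * R ∧ C ∈ Matrix.unitaryGroup (Config d L) ℂ ∧ ActsOn (Z D) C ∧
      IsGateCircuit {S ∈ 𝒢 | Disjoint S (Z 0)} D R := by
  induction h with
  | zero => exact ⟨1, 1, (one_mul 1).symm, one_mem _, ActsOn.one _, .zero⟩
  | @succ D M U hM _ ih =>
    obtain ⟨C, R, rfl, hC, actsOn_C, hR⟩ := ih
    obtain ⟨C', R', rfl, hC', actsOn_C', hR'⟩ := hM.exists_eq_mul (hZ D)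
    have actsOn_R' : ActsOn (Z D)ᶜ R' :=
      hR'.actsOn fun S hS => Finset.subset_compl_iff_disjoint_right.2 hS.2
    have comm : R' * C = C * R' := actsOn_R'.commute actsOn_C disjoint_compl_left
    refine ⟨C' * C, R' * R, ?_, mul_mem hC' hC, actsOn_C'.mul (actsOn_C.mono (hmono D.le_succ)),
      .succ (hR'.mono fun S hS => ⟨hS.1, hS.2.mono_right (hmono D.zero_le)⟩) hR⟩
    rw [mul_assoc, ← mul_assoc R', comm, mul_assoc, mul_assoc]

theorem IsCircuitOfBipartiteProduct.norm_eq_one {r : ℕ} {A : Finset (Fin L)} {Ψ : Ket d L}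
    (h : IsCircuitOfBipartiteProduct D r A Ψ) : ‖Ψ‖ = 1 := by
  obtain ⟨U, Φ, hU, hΦ, hΨ⟩ := h
  rw [← hΦ.norm_eq_one]
  simpa [← hΨ] using norm_toLp_mulVec hU.isGateCircuit.mem_unitaryGroup Φ.ofLp

end Circuit

/-! ### Disentanglers -/

section Disentangler

variable {d L : ℕ}

theorem factorizes_mulVec_iff {A : Finset (Fin L)} {V : Op d L} {Φ : Config d L → ℂ}
    (hV : V ∈ Matrix.unitaryGroup (Config d L) ℂ) (hA : ActsOn Aᶜ V) :
    Factorizes A (V *ᵥ Φ) ↔ Factorizes A Φ := by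
  refine ⟨fun h => ?_, fun h => h.mulVec_of_compl hA⟩
  have undo := h.mulVec_of_compl hA.conjTranspose
  rwa [Matrix.mulVec_mulVec, ← Matrix.star_eq_conjTranspose, Matrix.mem_unitaryGroup_iff'.1 hV,
    Matrix.one_mulVec] at undo

/-- The unitaries `C` and `C'` act within distance `w` of the left and of the right end of the
region `x, …, x + n - 1`, and together they disentangle that region from its complement. -/
structure IsDisentangler (w : ℕ) (x : ℤ) (n : ℕ) (C C' : Op d L) (Ψ : Ket d L) : Prop where
  left_mem : C ∈ Matrix.unitaryGroup (Config d L) ℂ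
  right_mem : C' ∈ Matrix.unitaryGroup (Config d L) ℂ
  actsOn_left : ActsOn (seg L (x - w) (2 * w)) C
  actsOn_right : ActsOn (seg L (x + n - w) (2 * w)) C'
  factorizes : Factorizes (seg L x n) ((C' * C) *ᵥ Ψ.ofLp)

theorem IsGateCircuit.exists_eq_mul_near {D r : ℕ} {𝒢 : Set (Finset (Fin L))} {U : Op d L}
    (h : IsGateCircuit 𝒢 D U) (h𝒢 : ∀ S ∈ 𝒢, IsArc S ∧ S.card ≤ r) (x : ℤ) :
    ∃ C R : Op d L, U = C * R ∧ C ∈ Matrix.unitaryGroup (Config d L) ℂ ∧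
      ActsOn (seg L (x - (1 + D * r : ℕ)) (2 * (1 + D * r))) C ∧
      IsGateCircuit {S ∈ 𝒢 | Disjoint S (seg L (x - 1) 2)} D R := by
  let Z : ℕ → Finset (Fin L) := fun j => seg L (x - (1 + j * r : ℕ)) (2 * (1 + j * r))
  have mono_Z : Monotone Z := monotone_nat_of_le_succ fun j =>
    seg_subset (by push_cast; linarith) (by push_cast; linarith)
  have grow_Z : ∀ j, ∀ S ∈ 𝒢, ¬Disjoint S (Z j) → S ⊆ Z (j + 1) := fun j S hS hmeets => by
    obtain ⟨-, b, m, -, rfl, hcard⟩ := (h𝒢 S hS).1.exists_eq_seg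
    exact (seg_subset_of_not_disjoint (hcard ▸ (h𝒢 _ hS).2) hmeets).trans
      (seg_subset (by push_cast; linarith) (by push_cast; linarith))
  simpa [Z] using h.exists_eq_mul mono_Z grow_Z

theorem IsCircuitOfBipartiteProduct.exists_isDisentangler {D r : ℕ} {x : ℤ} {n : ℕ} {Ψ : Ket d L}
    (h : IsCircuitOfBipartiteProduct D r (seg L x n) Ψ) (hn : n ≤ L) :
    ∃ C C' : Op d L, IsDisentangler (1 + D * r) x n C C' Ψ := by
  obtain ⟨U, Φ, hU, hΦ, hΨ⟩ := h
  obtain ⟨C, R, rfl, hC, actsOn_C, hR⟩ := hU.isGateCircuit.exists_eq_mul_near (fun _ => id) x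
  obtain ⟨C', R', rfl, hC', actsOn_C', hR'⟩ := hR.exists_eq_mul_near (fun _ hS => hS.1) (x + n)
  refine ⟨Cᴴ, C'ᴴ, Unitary.star_mem hC, Unitary.star_mem hC', actsOn_C.conjTranspose,
    actsOn_C'.conjTranspose, ?_⟩
  have cancel : C'ᴴ * Cᴴ * (C * (C' * R')) = R' := by
    rw [mul_assoc, ← mul_assoc Cᴴ, ← Matrix.star_eq_conjTranspose C,
      Matrix.mem_unitaryGroup_iff'.1 hC, one_mul, ← mul_assoc, ← Matrix.star_eq_conjTranspose,
      Matrix.mem_unitaryGroup_iff'.1 hC', one_mul]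
  rw [hΨ, Matrix.mulVec_mulVec, cancel]
  refine hR'.factorizes_mulVec (fun S hS => ?_) hΦ.factorizes
  obtain ⟨⟨⟨harc, -⟩, disjoint_left⟩, disjoint_right⟩ := hS
  obtain ⟨-, b, m, -, rfl, -⟩ := harc.exists_eq_seg
  exact seg_subset_or_subset_compl hn disjoint_left disjoint_right

theorem IsTranslationSymmetric.factorizes_relabel {Ψ : Ket d L} (h : IsTranslationSymmetric Ψ)
    {a : ℤ} {n : ℕ} {M : Op d L} (hM : Factorizes (seg L a n) (M *ᵥ Ψ.ofLp)) (k : ℕ) :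
    Factorizes (seg L (a + k) n) (relabel (finRotate L ^ k) M *ᵥ Ψ.ofLp) := by
  obtain ⟨c, hc⟩ := h.exists_relabel_mulVec k M
  rw [hc, ← seg_map_finRotate_pow]
  exact (hM.map _).smul c

theorem factorizes_inter_compl_of_commute {A B : Finset (Fin L)} {C C' E E' : Op d L}
    {Φ : Config d L → ℂ} (hA : Factorizes A ((C' * C) *ᵥ Φ)) (hB : Factorizes B ((E' * E) *ᵥ Φ))
    (mem_C' : C' ∈ Matrix.unitaryGroup (Config d L) ℂ)
    (mem_E' : E' ∈ Matrix.unitaryGroup (Config d L) ℂ)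
    (actsOn_C : ActsOn Bᶜ C) (actsOn_C' : ActsOn B C')
    (actsOn_E : ActsOn A E) (actsOn_E' : ActsOn Aᶜ E')
    (hCE : Commute C E) (hCE' : Commute C E') (hC'E : Commute C' E) (hC'E' : Commute C' E') :
    Factorizes (A ∩ Bᶜ) ((E * C) *ᵥ Φ) := by
  have cut_A : Factorizes A ((C' * (E' * (E * C))) *ᵥ Φ) := by
    have regroup : C' * (E' * (E * C)) = E' * (E * (C' * C)) := by
      rw [← mul_assoc C', hC'E'.eq, mul_assoc, ← mul_assoc C', hC'E.eq, mul_assoc]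
    rw [regroup, ← Matrix.mulVec_mulVec, ← Matrix.mulVec_mulVec]
    exact (hA.mulVec actsOn_E).mulVec_of_compl actsOn_E'
  have cut_B : Factorizes B ((C' * (E' * (E * C))) *ᵥ Φ) := by
    have regroup : C' * (E' * (E * C)) = C' * (C * (E' * E)) := by
      rw [← hCE.eq, ← mul_assoc C, hCE'.eq, mul_assoc]
    rw [regroup, ← Matrix.mulVec_mulVec, ← Matrix.mulVec_mulVec]
    exact (hB.mulVec_of_compl actsOn_C).mulVec actsOn_C'
  have cut := cut_A.inter cut_B.compl
  rwa [← Matrix.mulVec_mulVec, factorizes_mulVec_iff mem_C', ← Matrix.mulVec_mulVec,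
    factorizes_mulVec_iff mem_E'] at cut
  · exact actsOn_E'.mono (Finset.compl_subset_compl.2 Finset.inter_subset_left)
  · exact actsOn_C'.mono (Finset.subset_compl_comm.1 Finset.inter_subset_right)

/-- The region of length `s` is the part of the long region that sticks out of its translate by
`s`, and the disentanglers at the two far ends can be dropped. -/
theorem IsDisentangler.factorizes_seg {Ψ : Ket d L} {x : ℤ} {n w s : ℕ} {C C' : Op d L}
    (h : IsDisentangler w x n C C' Ψ) (hΨ : IsTranslationSymmetric Ψ) (hn : 6 * w ≤ n)
    (hnL : n + 6 * w ≤ L) (hs : 2 * w ≤ s) (hs' : s ≤ 4 * w) :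
    Factorizes (seg L x s) ((relabel (finRotate L ^ s) C * C) *ᵥ Ψ.ofLp) := by
  have translated := hΨ.factorizes_relabel h.factorizes s
  rw [map_mul] at translated
  have actsOn_E := h.actsOn_left.relabel_seg s
  have actsOn_E' := h.actsOn_right.relabel_seg s
  rw [← seg_inter_compl_seg (a := x) (m := s) (n := n) (by omega) (by omega)]
  refine factorizes_inter_compl_of_commute h.factorizes translated h.right_mem
    (relabel_mem_unitaryGroup _ h.right_mem)
    (h.actsOn_left.mono (Finset.subset_compl_iff_disjoint_right.2 (seg_disjoint ?_ ?_)))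
    (h.actsOn_right.mono (seg_subset ?_ ?_)) (actsOn_E.mono (seg_subset ?_ ?_))
    (actsOn_E'.mono (Finset.subset_compl_iff_disjoint_left.2 (seg_disjoint ?_ ?_)))
    (h.actsOn_left.commute actsOn_E (seg_disjoint ?_ ?_))
    (h.actsOn_left.commute actsOn_E' (seg_disjoint ?_ ?_))
    (actsOn_E.commute h.actsOn_right (seg_disjoint ?_ ?_)).symm
    (h.actsOn_right.commute actsOn_E' (seg_disjoint ?_ ?_)) <;> push_cast <;> omega

theorem IsDisentangler.factorizes_seg_add {Ψ : Ket d L} {x : ℤ} {n w s : ℕ} {C C' : Op d L}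
    (h : IsDisentangler w x n C C' Ψ) (hΨ : IsTranslationSymmetric Ψ) (hn : 6 * w ≤ n)
    (hnL : n + 6 * w ≤ L) (hs : 2 * w ≤ s) (hs' : s ≤ 4 * w) (k : ℕ) :
    Factorizes (seg L (x + k) s)
      ((relabel (finRotate L ^ (k + s)) C * relabel (finRotate L ^ k) C) *ᵥ Ψ.ofLp) := by
  have translated := hΨ.factorizes_relabel (h.factorizes_seg hΨ hn hnL hs hs') k
  rwa [map_mul, ← relabel_pow_add] at translated

end Disentangler

/-! ### Preparation from a product state -/

section ConstOn

variable {d L : ℕ} {z : Fin d} {B : Finset (Fin L)} {Φ : Config d L → ℂ}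

/-- Every site of `B` is in the basis state `z`. -/
def IsConstOn (z : Fin d) (B : Finset (Fin L)) (Φ : Config d L → ℂ) : Prop :=
  ∀ σ, Φ σ ≠ 0 → ∀ i ∈ B, σ i = z

theorem IsConstOn.mulVec (h : IsConstOn z B Φ) {M : Op d L} (hM : ActsOn Bᶜ M) :
    IsConstOn z B (M *ᵥ Φ) := by
  intro σ hσ i hi
  obtain ⟨τ, -, hτ⟩ := Finset.exists_ne_zero_of_sum_ne_zero hσ
  obtain ⟨u, hu⟩ := hM
  have agree : ∀ i ∉ Bᶜ, σ i = τ i := by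
    by_contra hne
    exact left_ne_zero_of_mul hτ ((hu σ τ).trans (if_neg hne))
  rw [agree i (by simpa using hi)]
  exact h τ (right_ne_zero_of_mul hτ) i hi

theorem Factorizes.exists_isConstOn_mulVec (h : Factorizes B Φ) (z : Fin d) :
    ∃ G ∈ Matrix.unitaryGroup (Config d L) ℂ, ActsOn B G ∧ IsConstOn z B (G *ᵥ Φ) := by
  obtain ⟨a, b, hab⟩ := h
  obtain ⟨u, hu, c, huc⟩ := exists_mem_unitaryGroup_mulVec_eq_single (fun _ : B => z) a
  refine ⟨localOp B u, localOp_mem_unitaryGroup hu, actsOn_localOp B u, fun σ hσ i hi => ?_⟩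
  rw [localOp_mulVec_of_eq_mul hab, huc] at hσ
  have restrict_eq : B.restrict σ = fun _ => z := by
    by_contra hne
    exact left_ne_zero_of_mul hσ ((Pi.single_apply _ _ _).trans (if_neg hne))
  exact congrFun restrict_eq ⟨i, hi⟩

theorem isProductState_single (hL : 0 < L) (z : Fin d) {c : ℂ} (hc : ‖c‖ = 1) :
    IsProductState (EuclideanSpace.single (fun _ => z) c : Ket d L) := by
  let o : Fin L := ⟨0, hL⟩
  refine ⟨fun i => EuclideanSpace.single z (if i = o then c else 1), fun i => ?_, fun σ => ?_⟩
  · dsimp only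
    split_ifs <;> simp [hc]
  · simp only [PiLp.single_apply, funext_iff, Finset.prod_ite_zero, Finset.mem_univ, true_imp_iff,
      Finset.prod_ite_eq', if_true]

theorem IsConstOn.isProductState (hL : 0 < L) {Φ : Ket d L} (h : IsConstOn z Finset.univ Φ.ofLp)
    (hΦ : ‖Φ‖ = 1) : IsProductState Φ := by
  obtain ⟨c, rfl⟩ : ∃ c, Φ = EuclideanSpace.single (fun _ => z) c := by
    refine ⟨Φ fun _ => z, PiLp.ext fun σ => ?_⟩
    rw [PiLp.single_apply]
    split_ifs with hσ
    · rw [hσ]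
    · by_contra hne
      exact hσ (funext fun i => h σ hne i (Finset.mem_univ i))
  exact isProductState_single hL z (by simpa using hΦ)

end ConstOn

section BlockLayer

variable {d L q r : ℕ} {S : Fin q → Finset (Fin L)} {G : Fin q → Op d L}

theorem pairwise_commute_of_actsOn (hS : ∀ j k, j ≠ k → Disjoint (S j) (S k))
    (hG : ∀ k, ActsOn (S k) (G k)) : Pairwise fun j k => Commute (G j) (G k) :=
  fun j k hjk => (hG j).commute (hG k) (hS j k hjk)

theorem IsLocalLayer.conjTranspose {M : Op d L} (h : IsLocalLayer r M) : IsLocalLayer r Mᴴ := by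
  obtain ⟨n, S, G, hS, hr, hG, rfl⟩ := h
  refine ⟨n, S, fun k => (G k)ᴴ, hS, hr,
    fun k => ⟨Unitary.star_mem (hG k).1, (hG k).2.conjTranspose⟩, ?_⟩
  rw [Matrix.conjTranspose_list_prod, List.map_ofFn]
  refine (List.reverse_perm _).prod_eq' (List.pairwise_reverse.2 (List.pairwise_ofFn.2 ?_))
  exact fun j k hjk => pairwise_commute_of_actsOn hS (fun k => (hG k).2.conjTranspose) hjk.ne'

theorem isLocalLayer_noncommProd (hS : ∀ j k, j ≠ k → Disjoint (S j) (S k))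
    (hr : ∀ k, IsArc (S k) ∧ (S k).card ≤ r)
    (hG : ∀ k, G k ∈ Matrix.unitaryGroup (Config d L) ℂ ∧ ActsOn (S k) (G k))
    (comm : (SetLike.coe (Finset.univ : Finset (Fin q))).Pairwise fun j k =>
      Commute (G j) (G k)) :
    IsLocalLayer r (Finset.univ.noncommProd G comm) := by
  refine ⟨q, S, G, hS, hr, hG, ?_⟩
  simp only [List.ofFn_eq_map, ← List.toFinset_finRange]
  exact Finset.noncommProd_toFinset _ _ _ (List.nodup_finRange q)

theorem actsOn_noncommProd {Z : Finset (Fin L)} {s : Finset (Fin q)} (hG : ∀ k ∈ s, ActsOn Z (G k))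
    (comm : (s : Set (Fin q)).Pairwise fun j k => Commute (G j) (G k)) :
    ActsOn Z (s.noncommProd G comm) :=
  Finset.noncommProd_induction s G comm (ActsOn Z) (fun _ _ => ActsOn.mul) (ActsOn.one Z) hG

theorem exists_isLocalLayer_isConstOn (hS : ∀ j k, j ≠ k → Disjoint (S j) (S k))
    (hr : ∀ k, IsArc (S k) ∧ (S k).card ≤ r) (hcover : ∀ i, ∃ j, i ∈ S j) {Φ : Config d L → ℂ}
    (hΦ : ∀ j, Factorizes (S j) Φ) (z : Fin d) :
    ∃ M, IsLocalLayer r M ∧ IsConstOn z Finset.univ (M *ᵥ Φ) := by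
  choose G hG_mem hG_acts hG_const using fun j => (hΦ j).exists_isConstOn_mulVec z
  have comm := pairwise_commute_of_actsOn hS hG_acts
  refine ⟨_, isLocalLayer_noncommProd hS hr (fun k => ⟨hG_mem k, hG_acts k⟩) (comm.set_pairwise _),
    fun σ hσ i _ => ?_⟩
  obtain ⟨j, hj⟩ := hcover i
  rw [← Finset.noncommProd_erase_mul _ (Finset.mem_univ j) _ (comm.set_pairwise _),
    ← Matrix.mulVec_mulVec] at hσ
  refine (hG_const j).mulVec (actsOn_noncommProd (fun k hk => ?_) _) σ hσ i hj
  exact (hG_acts k).mono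
    (Finset.subset_compl_iff_disjoint_right.2 (hS k j (Finset.ne_of_mem_erase hk)))

theorem IsLocalLayer.isCircuitOfProductState (hd : 0 < d) (hL : 0 < L) {E : Op d L} {Ψ : Ket d L}
    (hΨ : ‖Ψ‖ = 1) (hE : IsLocalLayer r E) (hS : ∀ j k, j ≠ k → Disjoint (S j) (S k))
    (hr : ∀ k, IsArc (S k) ∧ (S k).card ≤ r) (hcover : ∀ i, ∃ j, i ∈ S j)
    (hΦ : ∀ j, Factorizes (S j) (E *ᵥ Ψ.ofLp)) : IsCircuitOfProductState 2 r Ψ := by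
  obtain ⟨M, hM, hconst⟩ := exists_isLocalLayer_isConstOn hS hr hcover hΦ ⟨0, hd⟩
  rw [Matrix.mulVec_mulVec] at hconst
  have mem_ME := mul_mem hM.isGateLayer.mem_unitaryGroup hE.isGateLayer.mem_unitaryGroup
  refine ⟨(M * E)ᴴ, WithLp.toLp 2 ((M * E) *ᵥ Ψ.ofLp), ⟨![Eᴴ, Mᴴ], fun k => ?_, ?_⟩,
    hconst.isProductState hL ?_, ?_⟩
  · fin_cases k
    exacts [hE.conjTranspose, hM.conjTranspose]
  · simp [Matrix.conjTranspose_mul]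
  · rw [norm_toLp_mulVec mem_ME, WithLp.toLp_ofLp, hΨ]
  · rw [Matrix.mulVec_mulVec, ← Matrix.star_eq_conjTranspose, Matrix.mem_unitaryGroup_iff'.1 mem_ME,
      Matrix.one_mulVec]

end BlockLayer

section Cuts

/-- Positions `0 = cut 0 < ⋯ < cut q = L` that divide a ring of `L` sites into intervals of at
least `s` and at most `2 * s` sites. -/
structure IsCutting (L s q : ℕ) (cut : ℕ → ℕ) : Prop where
  zero : cut 0 = 0
  last : cut q = L
  add_le : ∀ i j, i < j → j ≤ q → cut i + s ≤ cut j
  le_add : ∀ j < q, cut (j + 1) ≤ cut j + 2 * s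

theorem exists_isCutting {L s : ℕ} (hs : 0 < s) (hL : s ≤ L) : ∃ q cut, IsCutting L s q cut := by
  have q_pos : 0 < L / s := Nat.div_pos hL hs
  have div_add_mod := Nat.div_add_mod L s
  have mod_lt := Nat.mod_lt L hs
  have mul_add_le {i j : ℕ} (h : i < j) : s * i + s ≤ s * j :=
    (mul_add_one s i).symm.trans_le (Nat.mul_le_mul_left s h)
  refine ⟨L / s, fun j => if j < L / s then s * j else L, ?_, ?_, fun i j hij hj => ?_,
    fun j hj => ?_⟩
  · simp [q_pos]
  · simp
  · have := mul_add_le hij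
    have := mul_add_le (hij.trans_le hj)
    split_ifs <;> omega
  · have := mul_add_one s j
    split_ifs with hj'
    · omega
    · rw [show L / s = j + 1 by omega] at div_add_mod
      omega

variable {L w q : ℕ} {cut : ℕ → ℕ}

theorem IsCutting.mono {s : ℕ} (h : IsCutting L s q cut) {i j : ℕ} (hij : i ≤ j) (hj : j ≤ q) :
    cut i ≤ cut j := by
  obtain rfl | hlt := hij.eq_or_lt
  exacts [le_rfl, (Nat.le_add_right _ _).trans (h.add_le i j hlt hj)]

theorem IsCutting.exists_mem_seg {s : ℕ} (h : IsCutting L s q cut) (x : ℤ) (i : Fin L) :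
    ∃ j : Fin q, i ∈ seg L (x + cut j) (cut (j + 1) - cut j) := by
  obtain ⟨k, hk⟩ := exists_mem_Ico_add_mul i.pos x i
  let beyond : ℕ → Prop := fun j => (i : ℤ) + k * L < x + cut j
  have exists_beyond : ∃ j, beyond j := ⟨q, by simpa only [beyond, h.last] using hk.2⟩
  classical
  obtain ⟨j, hj⟩ : ∃ j, Nat.find exists_beyond = j + 1 :=
    Nat.exists_eq_succ_of_ne_zero fun h0 =>
      ((Nat.find_eq_zero exists_beyond).1 h0).not_ge (by simpa [h.zero] using hk.1)
  have lt_cut : beyond (j + 1) := hj ▸ Nat.find_spec exists_beyond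
  have cut_le : x + cut j ≤ (i : ℤ) + k * L := not_lt.1 (Nat.find_min exists_beyond (by omega))
  have hjq : j < q := by
    have := Nat.find_min' exists_beyond (m := q) (by simpa only [beyond, h.last] using hk.2)
    omega
  have := h.mono j.le_succ hjq
  exact ⟨⟨j, hjq⟩, mem_seg.2 ⟨k, cut_le, by dsimp only [beyond] at lt_cut ⊢; omega⟩⟩

theorem IsCutting.disjoint_blocks {s : ℕ} (h : IsCutting L s q cut) (x : ℤ) (j k : Fin q)
    (hjk : j ≠ k) : Disjoint (seg L (x + cut j) (cut (j + 1) - cut j))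
      (seg L (x + cut k) (cut (k + 1) - cut k)) := by
  wlog hlt : j < k generalizing j k
  · exact (this k j hjk.symm (lt_of_le_of_ne (not_lt.1 hlt) hjk.symm)).symm
  have : cut (j + 1) ≤ cut k := h.mono (Nat.succ_le_of_lt hlt) k.2.le
  have : cut j ≤ cut (j + 1) := h.mono j.1.le_succ j.2
  have : cut k ≤ cut (k + 1) := h.mono k.1.le_succ k.2
  have : cut (k + 1) ≤ cut q := h.mono k.2 le_rfl
  have := h.zero
  have := h.last
  exact seg_disjoint (by omega) (by omega)

theorem IsCutting.disjoint_neighbourhoods (h : IsCutting L (2 * w) q cut) (x : ℤ) (j k : Fin q)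
    (hjk : j ≠ k) : Disjoint (seg L (x + cut j - w) (2 * w)) (seg L (x + cut k - w) (2 * w)) := by
  wlog hlt : j < k generalizing j k
  · exact (this k j hjk.symm (lt_of_le_of_ne (not_lt.1 hlt) hjk.symm)).symm
  have := h.add_le j k hlt k.2.le
  have := h.add_le k q k.2 le_rfl
  have := h.last
  exact seg_disjoint (by omega) (by omega)

theorem IsCutting.disjoint_neighbourhood_block (h : IsCutting L (2 * w) q cut) (x : ℤ)
    {i j next : Fin q} (hnext : next.1 = j + 1 ∨ j + 1 = q ∧ next.1 = 0) (hij : i ≠ j)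
    (hi : i ≠ next) : Disjoint (seg L (x + cut i - w) (2 * w))
      (seg L (x + cut j) (cut (j + 1) - cut j)) := by
  have hij' : i.1 ≠ j.1 := Fin.val_ne_of_ne hij
  have hi' : i.1 ≠ next.1 := Fin.val_ne_of_ne hi
  have hjq := j.2
  have := h.add_le j (j + 1) j.1.lt_succ_self hjq
  have := h.add_le i q i.2 le_rfl
  have := h.last
  have := h.zero
  rcases lt_or_gt_of_ne hij' with hlt | hgt
  · have := h.add_le i j hlt hjq.le
    have : cut (j + 1) + 2 * w ≤ L + cut i := by
      rcases hnext with hnext | ⟨hlast, hnext⟩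
      · have := h.add_le (j + 1) q (hnext ▸ next.2) le_rfl
        omega
      · have := h.add_le 0 i (by omega) i.2.le
        have := congrArg cut hlast
        omega
    exact seg_disjoint (by omega) (by omega)
  · have := h.add_le (j + 1) i (by omega) i.2.le
    exact (seg_disjoint (by omega) (by omega)).symm

end Cuts

section Assembly

variable {d L w q : ℕ} {cut : ℕ → ℕ}

theorem IsCutting.relabel_next (h : IsCutting L w q cut) (C : Op d L) {j next : Fin q}
    (hnext : next.1 = j + 1 ∨ j + 1 = q ∧ next.1 = 0) :
    relabel (finRotate L ^ cut next) C = relabel (finRotate L ^ cut (j + 1)) C := by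
  rcases hnext with hnext | ⟨hlast, hnext⟩
  · rw [hnext]
  · rw [hlast, hnext, h.last, h.zero, finRotate_pow_self, pow_zero]

theorem IsDisentangler.factorizes_noncommProd {Ψ : Ket d L} {x : ℤ} {n : ℕ} {C C' : Op d L}
    (h : IsDisentangler w x n C C' Ψ) (hΨ : IsTranslationSymmetric Ψ) (hn : 6 * w ≤ n)
    (hnL : n + 6 * w ≤ L) (hw : 0 < w) (hcut : IsCutting L (2 * w) q cut)
    (comm : Pairwise fun j k : Fin q =>
      Commute (relabel (finRotate L ^ cut j) C) (relabel (finRotate L ^ cut k) C))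
    (j : Fin q) :
    Factorizes (seg L (x + cut j) (cut (j + 1) - cut j))
      ((Finset.univ.noncommProd (fun k : Fin q => relabel (finRotate L ^ cut k) C)
        (comm.set_pairwise _)) *ᵥ Ψ.ofLp) := by
  obtain ⟨next, hnext⟩ : ∃ next : Fin q, next.1 = j + 1 ∨ j + 1 = q ∧ next.1 = 0 := by
    rcases lt_or_eq_of_le (Nat.succ_le_of_lt j.2) with hlt | heq
    exacts [⟨⟨j + 1, hlt⟩, Or.inl rfl⟩, ⟨⟨0, j.pos⟩, Or.inr ⟨heq, rfl⟩⟩]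
  have gap_ge := hcut.add_le j (j + 1) j.1.lt_succ_self j.2
  have gap_le := hcut.le_add j j.2
  have next_ne : next ≠ j := by
    rintro rfl
    have := hcut.zero
    have := hcut.last
    rcases hnext with hnext | ⟨hlast, hnext⟩
    · omega
    · rw [hlast, hnext] at gap_le
      omega
  have factorizes_block := h.factorizes_seg_add hΨ hn hnL (s := cut (j + 1) - cut j) (by omega)
    (by omega) (cut j)
  rw [Nat.add_sub_of_le (by omega), ← hcut.relabel_next C hnext] at factorizes_block
  rw [← Finset.noncommProd_erase_mul _ (Finset.mem_univ j) _ (comm.set_pairwise _),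
    ← Finset.noncommProd_erase_mul _ (Finset.mem_erase.2 ⟨next_ne, Finset.mem_univ _⟩) _
      (comm.set_pairwise _), mul_assoc, ← Matrix.mulVec_mulVec]
  refine factorizes_block.mulVec_of_compl (actsOn_noncommProd (fun i hi => ?_) _)
  obtain ⟨hi_next, hi_j, -⟩ := by simpa only [Finset.mem_erase] using hi
  have actsOn_i := h.actsOn_left.relabel_seg (cut i)
  rw [sub_add_eq_add_sub] at actsOn_i
  exact actsOn_i.mono (Finset.subset_compl_iff_disjoint_right.2
    (hcut.disjoint_neighbourhood_block x hnext hi_j hi_next))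

theorem IsDisentangler.isCircuitOfProductState (hd : 0 < d) {Ψ : Ket d L} {x : ℤ} {n : ℕ}
    {C C' : Op d L} (h : IsDisentangler w x n C C' Ψ) (hΨ : IsTranslationSymmetric Ψ)
    (hΨ_norm : ‖Ψ‖ = 1) (hw : 0 < w) (hn : 6 * w ≤ n) (hnL : n + 6 * w ≤ L) :
    IsCircuitOfProductState 2 (4 * w) Ψ := by
  have hL : 0 < L := by omega
  obtain ⟨q, cut, hcut⟩ := exists_isCutting (s := 2 * w) (L := L) (by omega) (by omega)
  have gates (k : Fin q) : relabel (finRotate L ^ cut k) C ∈ Matrix.unitaryGroup (Config d L) ℂ ∧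
      ActsOn (seg L (x + cut k - w) (2 * w)) (relabel (finRotate L ^ cut k) C) :=
    ⟨relabel_mem_unitaryGroup _ h.left_mem,
      sub_add_eq_add_sub x (w : ℤ) (cut k) ▸ h.actsOn_left.relabel_seg _⟩
  have comm := pairwise_commute_of_actsOn (hcut.disjoint_neighbourhoods x) fun k => (gates k).2
  have arcs {a : ℤ} {m : ℕ} (hm : m ≤ 4 * w) :
      IsArc (seg L a m) ∧ (seg L a m).card ≤ 4 * w :=
    ⟨isArc_seg hL a m, (card_seg_le hL a m).trans hm⟩
  refine (isLocalLayer_noncommProd (hcut.disjoint_neighbourhoods x) (fun k => arcs (by omega))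
    gates (comm.set_pairwise _)).isCircuitOfProductState hd hL hΨ_norm (hcut.disjoint_blocks x)
    (fun k => arcs ?_) (hcut.exists_mem_seg x)
    (h.factorizes_noncommProd hΨ hn hnL hw hcut comm)
  have := hcut.le_add k k.2
  omega

theorem IsTranslationSymmetric.isCircuitOfProductState (hd : 0 < d) {D r : ℕ} {A : Finset (Fin L)}
    {Ψ : Ket d L} (hΨ : IsTranslationSymmetric Ψ) (hA : IsArc A) (hcard : 6 * (1 + D * r) ≤ A.card)
    (hcard' : 6 * (1 + D * r) ≤ Aᶜ.card) (h : IsCircuitOfBipartiteProduct D r A Ψ) :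
    IsCircuitOfProductState 2 (4 * (1 + D * r)) Ψ := by
  obtain ⟨-, x, n, hn, rfl, hcard_eq⟩ := hA.exists_eq_seg
  rw [Finset.card_compl, Fintype.card_fin] at hcard'
  obtain ⟨C, C', hC⟩ := h.exists_isDisentangler hn
  exact hC.isCircuitOfProductState hd hΨ h.norm_eq_one (by omega) (by omega) (by omega)

end Assembly

/-! ### Operators on a few sites that annihilate the state -/

section Annihilator

variable {d L : ℕ}

theorem IsTranslationSymmetric.exists_localOp_seg_mulVec_eq_zero {Ψ : Ket d L}
    (hΨ : IsTranslationSymmetric Ψ) {a : ℤ} {m : ℕ} {M : Op d L} (hL : 0 < L) (hM : M ≠ 0)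
    (hMa : ActsOn (seg L a m) M) (hMΨ : M *ᵥ Ψ.ofLp = 0) :
    ∃ u ≠ 0, localOp (seg L 0 m) u *ᵥ Ψ.ofLp = 0 := by
  obtain ⟨k, hk⟩ := Int.eq_ofNat_of_zero_le (Int.emod_nonneg (-a) (b := L) (by omega))
  have actsOn_relabel := hMa.relabel_seg k
  rw [← hk, show a + -a % L = 0 + (-(-a / L)) * L by linarith [Int.emod_add_ediv_mul (-a) L],
    seg_add_int_mul] at actsOn_relabel
  obtain ⟨u, hu⟩ := actsOn_iff_exists_localOp.1 actsOn_relabel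
  obtain ⟨c, hc⟩ := hΨ.exists_relabel_mulVec k M
  refine ⟨u, ?_, ?_⟩
  · rintro rfl
    rw [localOp_zero, map_eq_zero_iff _ (relabel _).injective] at hu
    exact hM hu
  · rw [← hu, hc, hMΨ]
    exact smul_zero c

variable [Nontrivial (Fin d)]

theorem Factorizes.exists_actsOn_mulVec_eq_zero {A I : Finset (Fin L)} {V : Op d L}
    {Φ : Config d L → ℂ} (h : Factorizes A (V *ᵥ Φ)) (hA : A.Nonempty) (hAI : A ⊆ I)
    (hV : V ∈ Matrix.unitaryGroup (Config d L) ℂ) (hVI : ActsOn I V) :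
    ∃ M : Op d L, M ≠ 0 ∧ ActsOn I M ∧ M *ᵥ Φ = 0 := by
  have : Nonempty A := hA.to_subtype
  obtain ⟨u, hu, kills⟩ := h.exists_localOp_mulVec_eq_zero
  refine ⟨localOp A u * V, fun h0 => localOp_ne_zero hu ?_, ((actsOn_localOp A u).mono hAI).mul hVI,
    by rw [← Matrix.mulVec_mulVec, kills]⟩
  rw [← mul_one (localOp A u), ← Matrix.mem_unitaryGroup_iff.1 hV, ← mul_assoc, h0, zero_mul]

theorem IsDisentangler.exists_actsOn_seg_mulVec_eq_zero {w n : ℕ} {x : ℤ} {C C' : Op d L}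
    {Ψ : Ket d L} (h : IsDisentangler w x n C C' Ψ) (hΨ : IsTranslationSymmetric Ψ) (hw : 0 < w)
    (hn : 0 < n) (hnL : n < L) :
    ∃ (a : ℤ) (M : Op d L), M ≠ 0 ∧ ActsOn (seg L a (8 * w)) M ∧ M *ᵥ Ψ.ofLp = 0 := by
  have hL : 0 < L := by omega
  have nearby {a b : ℤ} {m l : ℕ} {N : Op d L} (hN : ActsOn (seg L b m) N) (hab : a ≤ b)
      (hba : b + m ≤ a + l) : ActsOn (seg L a l) N := hN.mono (seg_subset hab hba)
  have mem_mul := mul_mem h.right_mem h.left_mem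
  rcases lt_or_ge n (6 * w) with short | long
  · exact ⟨x - w, h.factorizes.exists_actsOn_mulVec_eq_zero (seg_nonempty hL x hn)
      (seg_subset (by omega) (by omega)) mem_mul
      ((nearby h.actsOn_right (by omega) (by omega)).mul
        (nearby h.actsOn_left (by omega) (by omega)))⟩
  rcases lt_or_ge L (n + 6 * w) with short_compl | long_compl
  · have factorizes_compl := compl_seg (a := x) hnL.le ▸ h.factorizes.compl
    have actsOn_left := h.actsOn_left
    rw [← seg_add_period] at actsOn_left
    exact ⟨x + n - w, factorizes_compl.exists_actsOn_mulVec_eq_zero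
      (seg_nonempty hL _ (by omega)) (seg_subset (by omega) (by omega)) mem_mul
      ((nearby h.actsOn_right (by omega) (by omega)).mul
        (nearby actsOn_left (by omega) (by omega)))⟩
  · have factorizes_interval := h.factorizes_seg hΨ long long_compl le_rfl (by omega)
    exact ⟨x - w, factorizes_interval.exists_actsOn_mulVec_eq_zero (seg_nonempty hL x (by omega))
      (seg_subset (by omega) (by omega))
      (mul_mem (relabel_mem_unitaryGroup _ h.left_mem) h.left_mem)
      ((nearby (h.actsOn_left.relabel_seg _) (by omega) (by omega)).mul
        (nearby h.actsOn_left (by omega) (by omega)))⟩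

theorem IsCircuitOfBipartiteProduct.exists_localOp_seg_mulVec_eq_zero {D r : ℕ}
    {A : Finset (Fin L)} {Ψ : Ket d L} (h : IsCircuitOfBipartiteProduct D r A Ψ)
    (hΨ : IsTranslationSymmetric Ψ) (hA : IsArc A) (hA_nonempty : A.Nonempty)
    (hA_compl : Aᶜ.Nonempty) :
    ∃ u ≠ 0, localOp (seg L 0 (8 * (1 + D * r))) u *ᵥ Ψ.ofLp = 0 := by
  obtain ⟨hL, x, n, hn, rfl, hcard⟩ := hA.exists_eq_seg
  have n_pos : 0 < n := hcard ▸ hA_nonempty.card_pos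
  have n_lt : n < L := by
    have := hA_compl.card_pos
    rw [Finset.card_compl, hcard, Fintype.card_fin] at this
    omega
  obtain ⟨C, C', hC⟩ := h.exists_isDisentangler hn
  obtain ⟨a, M, hM, hMa, hMΨ⟩ :=
    hC.exists_actsOn_seg_mulVec_eq_zero hΨ (by omega) n_pos n_lt
  exact hΨ.exists_localOp_seg_mulVec_eq_zero hL hM hMa hMΨ

end Annihilator

/-! ### Counting the states that a local operator annihilates in every block -/

section Types

variable {X Y R 𝕜 : Type*} {n N : ℕ}

theorem exists_forall_eq_sum_of_sum_mul_eq_zero [Fintype X] [Field 𝕜] {q : X → 𝕜} (hq : q ≠ 0)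
    (hX : Fintype.card X = n + 1) :
    ∃ (A : X → Fin n → 𝕜) (j : Fin n → X), ∀ f : X → 𝕜, ∑ x, q x * f x = 0 →
      ∀ x, f x = ∑ y, A x y * f (j y) := by
  classical
  obtain ⟨x₀, hx₀⟩ := Function.ne_iff.1 hq
  let e := Fintype.equivFinOfCardEq hX
  let j : Fin n → X := fun y => e.symm ((e x₀).succAbove y)
  have j_injective : Function.Injective j := e.symm.injective.comp Fin.succAbove_right_injective
  refine ⟨fun x y => if x = x₀ then -q (j y) / q x₀ else if x = j y then 1 else 0, j,
    fun f hf x => ?_⟩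
  by_cases hx : x = x₀
  · rw [← e.symm.sum_comp, Fin.sum_univ_succAbove _ (e x₀), e.symm_apply_apply] at hf
    simp only [hx, if_true, div_mul_eq_mul_div, ← Finset.sum_div, neg_mul, Finset.sum_neg_distrib]
    rw [eq_div_iff hx₀]
    linear_combination hf
  · obtain ⟨y, hy⟩ := Fin.exists_succAbove_eq (e.injective.ne hx)
    obtain rfl : j y = x := by simp [j, hy]
    simp [hx, j_injective.eq_iff]

theorem eq_sum_prod_mul_of_update [CommSemiring 𝕜] [Fintype Y] {A : X → Y → 𝕜} {j : Y → X}
    {f : (Fin N → X) → 𝕜}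
    (hf : ∀ a k, f a = ∑ y, A (a k) y * f (Function.update a k (j y))) (a : Fin N → X) :
    f a = ∑ b : Fin N → Y, (∏ k, A (a k) (b k)) * f (j ∘ b) := by
  induction N with
  | zero => simp [Subsingleton.elim _ a]
  | succ N ih =>
    have expand_tail (x : X) : f (Fin.cons x (Fin.tail a)) =
        ∑ b : Fin N → Y, (∏ k, A (a k.succ) (b k)) * f (Fin.cons x (j ∘ b)) :=
      ih (f := fun t => f (Fin.cons x t)) (fun t k => by simpa using hf (Fin.cons x t) k.succ) _
    have update_zero (x : X) : Function.update a 0 x = Fin.cons x (Fin.tail a) := by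
      rw [← Fin.update_cons_zero (a 0), Fin.cons_self_tail]
    calc f a = ∑ y, A (a 0) y * f (Fin.cons (j y) (Fin.tail a)) := by
          simpa only [update_zero] using hf a 0
      _ = ∑ y, ∑ b : Fin N → Y,
          A (a 0) y * (∏ k, A (a k.succ) (b k)) * f (Fin.cons (j y) (j ∘ b)) := by
        simp only [expand_tail, Finset.mul_sum, mul_assoc]
      _ = _ := by
        rw [← (Fin.consEquiv fun _ : Fin (N + 1) => Y).sum_comp, Fintype.sum_prod_type]
        simp [Fin.consEquiv, Fin.prod_univ_succ, Fin.comp_cons]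

/-- The multiset of the pairs `(a k, b k)`: the joint type of the words `a` and `b`. -/
def jointType (a : Fin N → X) (b : Fin N → Y) : Sym (X × Y) N :=
  ⟨Finset.univ.val.map fun k => (a k, b k), by simp⟩

theorem prod_map_jointType [CommMonoid R] (F : X × Y → R) (a : Fin N → X) (b : Fin N → Y) :
    ((jointType a b : Multiset (X × Y)).map F).prod = ∏ k, F (a k, b k) := by
  rw [jointType, Sym.coe_mk, Multiset.map_map]
  rfl

variable (X Y R 𝕜 N) in
/-- `c ↦ ∑ b, c (jointType a b, b, r)`, as a function of the word `a` and the parameter `r`. -/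
def jointTypeSum [CommSemiring 𝕜] [Fintype Y] :
    (Sym (X × Y) N × (Fin N → Y) × R → 𝕜) →ₗ[𝕜] (Fin N → X) × R → 𝕜 :=
  LinearMap.pi fun p => ∑ b, LinearMap.proj (jointType p.1 b, b, p.2)

theorem mem_range_jointTypeSum [Fintype X] [Field 𝕜] {q : X → 𝕜} (hq : q ≠ 0)
    (hX : Fintype.card X = n + 1) {f : (Fin N → X) × R → 𝕜}
    (hf : ∀ a k r, ∑ x, q x * f (Function.update a k x, r) = 0) :
    f ∈ LinearMap.range (jointTypeSum X (Fin n) R 𝕜 N) := by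
  obtain ⟨A, j, hA⟩ := exists_forall_eq_sum_of_sum_mul_eq_zero hq hX
  refine ⟨fun p => ((p.1 : Multiset (X × Fin n)).map fun xy => A xy.1 xy.2).prod *
    f (j ∘ p.2.1, p.2.2), ?_⟩
  ext ⟨a, r⟩
  have reduce (a : Fin N → X) (k : Fin N) :
      f (a, r) = ∑ y, A (a k) y * f (Function.update a k (j y), r) := by
    simpa using hA (fun x => f (Function.update a k x, r)) (hf a k r) (a k)
  rw [eq_sum_prod_mul_of_update (f := fun a => f (a, r)) reduce a]
  simp [jointTypeSum, prod_map_jointType]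

end Types

section Blocks

variable {ι α 𝕜 : Type*} [Fintype ι] [DecidableEq ι] {N n : ℕ} {S : Finset ι}
  {g : Fin N → Equiv.Perm ι}

open scoped Classical in
/-- A configuration of all sites consists of its restrictions to the disjoint translates `g k S` of
`S` and its restriction to the sites outside of all the translates. -/
def blockEquiv (α : Type*) (h : Function.Injective fun p : Fin N × S => g p.1 p.2) :
    (ι → α) ≃ (Fin N → S → α) × ({i // i ∉ Set.range fun p : Fin N × S => g p.1 p.2} → α) :=
  (Equiv.piEquivPiSubtypeProd (· ∈ Set.range fun p : Fin N × S => g p.1 p.2) fun _ => α).trans <|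
    Equiv.prodCongr
      (((Equiv.ofInjective _ h).symm.arrowCongr (Equiv.refl α)).trans (Equiv.curry _ _ _))
      (Equiv.refl _)

theorem blockEquiv_symm_update_comp (h : Function.Injective fun p : Fin N × S => g p.1 p.2)
    (a : Fin N → S → α) (k : Fin N) (x : S → α)
    (c : {i // i ∉ Set.range fun p : Fin N × S => g p.1 p.2} → α) :
    (blockEquiv α h).symm (Function.update a k x, c) ∘ g k =
      (splitEquiv α S).symm (x, Sᶜ.restrict ((blockEquiv α h).symm (a, c) ∘ g k)) := by
  have symm_eq (a : Fin N → S → α) (k : Fin N) (s : S) :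
      (blockEquiv α h).symm (a, c) (g k s) = a k s :=
    congrFun₂ (congrArg Prod.fst ((blockEquiv α h).apply_symm_apply (a, c))) k s
  have symm_eq_of_notMem (a : Fin N → S → α) (i : ι)
      (hi : i ∉ Set.range fun p : Fin N × S => g p.1 p.2) :
      (blockEquiv α h).symm (a, c) i = c ⟨i, hi⟩ :=
    congrFun (congrArg Prod.snd ((blockEquiv α h).apply_symm_apply (a, c))) ⟨i, hi⟩
  ext i
  by_cases hi : i ∈ S
  · simp [splitEquiv, hi, symm_eq _ k ⟨i, hi⟩]
  by_cases hblock : g k i ∈ Set.range fun p : Fin N × S => g p.1 p.2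
  · obtain ⟨⟨l, s⟩, hls⟩ := hblock
    have ne : l ≠ k := by
      rintro rfl
      exact hi ((g l).injective hls ▸ s.2)
    simp [splitEquiv, hi, ← hls, symm_eq, ne]
  · simp [splitEquiv, hi, symm_eq_of_notMem _ _ hblock]

theorem mem_range_jointTypeSum_of_localOp_mulVec_eq_zero [Fintype α] [DecidableEq α] [Field 𝕜]
    (h : Function.Injective fun p : Fin N × S => g p.1 p.2) {u : Matrix (S → α) (S → α) 𝕜}
    (hu : u ≠ 0) (hα : Fintype.card (S → α) = n + 1) {Φ : (ι → α) → 𝕜}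
    (hΦ : ∀ k σ, Φ (σ ∘ g k) = Φ σ) (hΦu : localOp S u *ᵥ Φ = 0) :
    Φ ∘ (blockEquiv α h).symm ∈ LinearMap.range (jointTypeSum (S → α) (Fin n) _ 𝕜 N) := by
  obtain ⟨x₁, hx₁⟩ := Function.ne_iff.1 hu
  refine mem_range_jointTypeSum hx₁ hα fun a k c => ?_
  let τ := Sᶜ.restrict ((blockEquiv α h).symm (a, c) ∘ g k)
  have row := congrFun hΦu ((splitEquiv α S).symm (x₁, τ))
  rw [localOp_mulVec, restrict_splitEquiv_symm, restrict_compl_splitEquiv_symm] at row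
  refine (Finset.sum_congr rfl fun x _ => ?_).trans row
  rw [Function.comp_apply, ← hΦ k, blockEquiv_symm_update_comp]

theorem finrank_span_mul_pow_le [Fintype α] [DecidableEq α] [Field 𝕜]
    (h : Function.Injective fun p : Fin N × S => g p.1 p.2) (hα : Fintype.card (S → α) = n + 1)
    {V : Set ((ι → α) → 𝕜)} (hV : ∀ Φ ∈ V, ∀ k σ, Φ (σ ∘ g k) = Φ σ)
    (hVu : ∀ Φ ∈ V, ∃ u ≠ 0, localOp S u *ᵥ Φ = 0) :
    Module.finrank 𝕜 (Submodule.span 𝕜 V) * (n + 1) ^ N ≤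
      Nat.multichoose ((n + 1) * n) N * n ^ N * Fintype.card (ι → α) := by
  classical
  let C := {i // i ∉ Set.range fun p : Fin N × S => g p.1 p.2} → α
  let F := LinearMap.funLeft 𝕜 𝕜 (blockEquiv α h) ∘ₗ jointTypeSum (S → α) (Fin n) C 𝕜 N
  have span_le : Submodule.span 𝕜 V ≤ LinearMap.range F := Submodule.span_le.2 fun Φ hΦ => by
    obtain ⟨u, hu, hΦu⟩ := hVu Φ hΦ
    obtain ⟨c, hc⟩ := mem_range_jointTypeSum_of_localOp_mulVec_eq_zero h hu hα (hV Φ hΦ) hΦu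
    exact ⟨c, by ext σ; simp [F, C, LinearMap.funLeft_apply, hc]⟩
  have finrank_le := (Submodule.finrank_mono span_le).trans F.finrank_range_le
  have card_eq : Fintype.card (ι → α) = (n + 1) ^ N * Fintype.card C := by
    rw [Fintype.card_congr (blockEquiv α h), Fintype.card_prod, Fintype.card_fun, hα,
      Fintype.card_fin]
  rw [Module.finrank_fintype_fun_eq_card, Fintype.card_prod, Fintype.card_prod,
    Sym.card_sym_eq_multichoose, Fintype.card_prod, hα, Fintype.card_fun, Fintype.card_fin,
    Fintype.card_fin] at finrank_le
  rw [card_eq]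
  calc _ ≤ _ := Nat.mul_le_mul_right _ finrank_le
    _ = _ := by ring

end Blocks

/-! ### The zero-momentum subspace and mixtures -/

section TranslationProjector

variable {d L : ℕ}

theorem translation_pow_apply (n : ℕ) (σ τ : Config d L) :
    (translation d L ^ n) σ τ = if τ = σ ∘ ⇑(finRotate L ^ n) then 1 else 0 := by
  have column := congrFun (translation_pow_mulVec n (Pi.single τ (1 : ℂ))) σ
  rw [Matrix.mulVec_single_one] at column
  simpa [Pi.single_apply, eq_comm] using column

theorem translation_pow_self (d L : ℕ) : translation d L ^ L = 1 := by
  ext σ τ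
  simp [translation_pow_apply, finRotate_pow_self, Matrix.one_apply, eq_comm]

theorem translation_mul_translationProjector (d L : ℕ) :
    translation d L * translationProjector d L = translationProjector d L := by
  have shift := Finset.sum_range_succ' (translation d L ^ ·) L
  rw [Finset.sum_range_succ, translation_pow_self, pow_zero, add_left_inj] at shift
  simp only [translationProjector, Matrix.mul_smul, Finset.mul_sum, ← pow_succ', ← shift]

theorem isIdempotentElem_translationProjector (hL : 0 < L) :
    IsIdempotentElem (translationProjector d L) := by
  have pow_mul (n : ℕ) :
      translation d L ^ n * translationProjector d L = translationProjector d L := by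
    induction n with
    | zero => rw [pow_zero, one_mul]
    | succ n ih => rw [pow_succ, mul_assoc, translation_mul_translationProjector, ih]
  have hL' : (L : ℂ) ≠ 0 := by exact_mod_cast hL.ne'
  rw [IsIdempotentElem]
  nth_rw 1 [translationProjector]
  rw [Matrix.smul_mul, Finset.sum_mul, Finset.sum_congr rfl fun n _ => pow_mul n,
    Finset.sum_const, Finset.card_range, ← Nat.cast_smul_eq_nsmul ℂ, inv_smul_smul₀ hL']

theorem trace_translationProjector (hL : 0 < L) :
    (translationProjector d L).trace = (translationProjector d L).rank := by
  have isIdempotentElem_toLin' := (isIdempotentElem_translationProjector (d := d) hL).map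
    (Matrix.toLinAlgEquiv' (R := ℂ) (n := Config d L))
  rw [← Matrix.trace_toLin'_eq]
  exact (LinearMap.isProj_range_iff_isIdempotentElem _ |>.2 isIdempotentElem_toLin').trace

theorem card_config_le_mul_rank (hL : 0 < L) :
    Fintype.card (Config d L) ≤ L * (translationProjector d L).rank := by
  have hL' : (L : ℂ) ≠ 0 := by exact_mod_cast hL.ne'
  have trace_pow (n : ℕ) : (translation d L ^ n).trace =
      (Finset.univ.filter fun σ : Config d L => σ = σ ∘ ⇑(finRotate L ^ n)).card := by
    simp [Matrix.trace, translation_pow_apply]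
  have mul_rank_eq : L * (translationProjector d L).rank = ∑ n ∈ Finset.range L,
      (Finset.univ.filter fun σ : Config d L => σ = σ ∘ ⇑(finRotate L ^ n)).card := by
    have := trace_translationProjector (d := d) hL
    rw [translationProjector, Matrix.trace_smul, Matrix.trace_sum, smul_eq_mul,
      inv_mul_eq_iff_eq_mul₀ hL', ← translationProjector] at this
    simp only [trace_pow] at this
    exact_mod_cast this.symm
  rw [mul_rank_eq]
  calc Fintype.card (Config d L)
      = (Finset.univ.filter fun σ : Config d L => σ = σ ∘ ⇑(finRotate L ^ 0)).card := by simp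
    _ ≤ _ := Finset.single_le_sum (f := fun n =>
        (Finset.univ.filter fun σ : Config d L => σ = σ ∘ ⇑(finRotate L ^ n)).card)
        (fun _ _ => Nat.zero_le _) (Finset.mem_range.2 hL)

theorem rank_mmis (hd : 0 < d) (hL : 0 < L) :
    (mmis d L).rank = (translationProjector d L).rank := by
  have : Nonempty (Fin d) := ⟨⟨0, hd⟩⟩
  refine Matrix.rank_smul_of_mem_nonZeroDivisors _ (mem_nonZeroDivisors_of_ne_zero (inv_ne_zero ?_))
  rw [trace_translationProjector hL, Nat.cast_ne_zero, ← Nat.pos_iff_ne_zero]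
  exact Nat.pos_of_mul_pos_left (Fintype.card_pos.trans_le (card_config_le_mul_rank hL))

end TranslationProjector

section Mixture

variable {κ m n : Type*} [Fintype κ] [Finite m] [Fintype n] {w : κ → ℝ} {v : κ → n → ℂ}

open scoped ComplexOrder in
theorem mulVec_eq_zero_of_mul_sum_smul_vecMulVec_eq_zero (hw : ∀ i, 0 ≤ w i) {Q : Matrix m n ℂ}
    (hQ : Q * ∑ i, w i • Matrix.vecMulVec (v i) (star (v i)) = 0) {i : κ} (hi : w i ≠ 0) :
    Q *ᵥ v i = 0 := by
  have := Fintype.ofFinite m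
  have trace_eq : ∑ i, w i • (Q *ᵥ v i ⬝ᵥ star (Q *ᵥ v i)) = 0 := by
    have := congrArg (fun M => (M * Qᴴ).trace) hQ
    simpa only [Matrix.mul_sum, Matrix.sum_mul, Matrix.mul_smul, Matrix.smul_mul,
      Matrix.mul_vecMulVec, Matrix.vecMulVec_mul, ← Matrix.star_mulVec, Matrix.trace_sum,
      Matrix.trace_smul, Matrix.trace_vecMulVec, Matrix.zero_mul, Matrix.trace_zero] using this
  have term_nonneg (i : κ) : 0 ≤ w i • (Q *ᵥ v i ⬝ᵥ star (Q *ᵥ v i)) :=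
    smul_nonneg (hw i) (dotProduct_self_star_nonneg _)
  have term_eq := (Finset.sum_eq_zero_iff_of_nonneg fun i _ => term_nonneg i).1 trace_eq i
    (Finset.mem_univ i)
  exact dotProduct_self_star_eq_zero.1 ((smul_eq_zero.1 term_eq).resolve_left hi)

theorem rank_sum_smul_vecMulVec_le :
    (∑ i, w i • Matrix.vecMulVec (v i) (star (v i))).rank ≤
      Module.finrank ℂ (Submodule.span ℂ (v '' {i | w i ≠ 0})) := by
  refine Submodule.finrank_mono ?_
  rintro _ ⟨x, rfl⟩
  simp only [Matrix.mulVecLin_apply, Matrix.sum_mulVec, Matrix.smul_mulVec,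
    Matrix.vecMulVec_mulVec, op_smul_eq_smul]
  refine Submodule.sum_mem _ fun i _ => ?_
  by_cases hi : w i = 0
  · simp [hi]
  · exact Submodule.smul_of_tower_mem _ _ <| Submodule.smul_mem _ _ <|
      Submodule.subset_span (Set.mem_image_of_mem v hi)

end Mixture

/-! ### Mixtures of short-range entangled states -/

theorem multichoose_le_add_pow (c N : ℕ) : Nat.multichoose c N ≤ (N + c) ^ c := by
  rcases c with _ | c
  · rcases N with _ | N <;> simp
  · rw [Nat.multichoose_eq, Nat.choose_symm_of_eq_add (show c + 1 + N - 1 = N + c by omega)]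
    calc _ ≤ (c + 1 + N - 1) ^ c := Nat.choose_le_pow _ _
      _ ≤ (N + (c + 1)) ^ c := Nat.pow_le_pow_left (by omega) c
      _ ≤ _ := Nat.pow_le_pow_right (by omega) c.le_succ

theorem exists_forall_mul_multichoose_mul_pow_lt (c m n : ℕ) :
    ∃ N₀ : ℕ, ∀ N ≥ N₀, m * (N + 1) * (Nat.multichoose c N * n ^ N) < (n + 1) ^ N := by
  let e := c + 1
  let C := m * (e + 1) ^ e
  have isLittleO := isLittleO_pow_const_mul_const_pow_const_pow_of_norm_lt e
    (show ‖(n : ℝ)‖ < (n + 1 : ℝ) by simp)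
  obtain ⟨N₀, hN₀⟩ := Filter.eventually_atTop.1
    (isLittleO.def (c := 1 / (C + 1 : ℝ)) (by positivity))
  refine ⟨max N₀ 1, fun N hN => ?_⟩
  have pow_lt : C * (N ^ e * n ^ N) < (n + 1) ^ N := by
    have := hN₀ N (le_of_max_le_left hN)
    simp only [Real.norm_eq_abs, abs_of_nonneg (by positivity : (0 : ℝ) ≤ N ^ e * n ^ N),
      abs_of_nonneg (by positivity : (0 : ℝ) ≤ (n + 1) ^ N)] at this
    rw [one_div_mul_eq_div, le_div_iff₀ (by positivity)] at this
    have le_pow : N ^ e * n ^ N * (C + 1) ≤ (n + 1) ^ N := by exact_mod_cast this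
    rcases Nat.eq_zero_or_pos (N ^ e * n ^ N) with h0 | hpos
    · rw [h0, mul_zero]
      positivity
    · linarith
  have one_le : 1 ≤ N := le_of_max_le_right hN
  calc m * (N + 1) * (Nat.multichoose c N * n ^ N)
      ≤ m * (N + e) * ((N + e) ^ c * n ^ N) := by
        gcongr
        · exact Nat.le_add_left 1 c
        · exact (multichoose_le_add_pow c N).trans (Nat.pow_le_pow_left (by omega) c)
    _ = m * (N + e) ^ e * n ^ N := by ring
    _ ≤ m * ((e + 1) * N) ^ e * n ^ N := by
        gcongr
        nlinarith
    _ = C * (N ^ e * n ^ N) := by rw [mul_pow]; ring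
    _ < (n + 1) ^ N := pow_lt

theorem injective_finRotate_pow_seg {L m : ℕ} :
    Function.Injective fun p : Fin (L / m) × seg L 0 m => (finRotate L ^ (m * p.1 : ℕ)) p.2 := by
  rintro ⟨k, i⟩ ⟨l, j⟩ h
  wlog hkl : k ≤ l generalizing k l i j
  · exact (this l j k i h.symm (le_of_not_ge hkl)).symm
  dsimp only at h
  rcases hkl.eq_or_lt with rfl | lt
  · rw [Subtype.ext ((finRotate L ^ _).injective h)]
  · have mem (k : Fin (L / m)) (i : seg L 0 m) :
        (finRotate L ^ (m * k : ℕ)) i ∈ seg L ((m * k : ℕ) : ℤ) m := by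
      rw [← zero_add ((m * k : ℕ) : ℤ), ← seg_map_finRotate_pow]
      exact Finset.mem_map_of_mem _ i.2
    have step : m * (k + 1) ≤ m * l := Nat.mul_le_mul_left m lt
    have last : m * (l + 1) ≤ L := (Nat.mul_le_mul_left m l.2).trans (Nat.mul_div_le L m)
    rw [mul_add_one] at step last
    exact absurd (h ▸ mem k i) (Finset.disjoint_right.1
      (seg_disjoint (by exact_mod_cast step) (by push_cast; omega)) (mem l j))

theorem exists_rank_mmis_le_finrank_span {d L D r : ℕ} (hd : 2 ≤ d)
    (h : mmis d L ∈ shortRangeBipartiteMixtures d L D r) :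
    ∃ V : Set (Config d L → ℂ), (mmis d L).rank ≤ Module.finrank ℂ (Submodule.span ℂ V) ∧
      ∀ Φ ∈ V, translation d L *ᵥ Φ = Φ ∧
        ∃ u ≠ 0, localOp (seg L 0 (8 * (1 + D * r))) u *ᵥ Φ = 0 := by
  have : Nontrivial (Fin d) := Fin.nontrivial_iff_two_le.2 hd
  obtain ⟨κ, _, w, ρ, hw, -, hρ, sum_eq⟩ := mem_convexHull_iff_exists_fintype.1 h
  choose A Ψ hA hA_nonempty hA_compl hΨ ρ_eq using hρ
  simp only [ρ_eq, ketBra] at sum_eq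
  refine ⟨(fun i => (Ψ i).ofLp) '' {i | w i ≠ 0}, sum_eq ▸ rank_sum_smul_vecMulVec_le, ?_⟩
  rintro _ ⟨i, hi, rfl⟩
  have sub_one_mul_mmis : (translation d L - 1) * mmis d L = 0 := by
    rw [mmis, Matrix.mul_smul, sub_mul, translation_mul_translationProjector, one_mul, sub_self,
      smul_zero]
  have fixed : translation d L *ᵥ (Ψ i).ofLp = (Ψ i).ofLp := by
    have := mulVec_eq_zero_of_mul_sum_smul_vecMulVec_eq_zero hw (sum_eq ▸ sub_one_mul_mmis) hi
    rwa [Matrix.sub_mulVec, Matrix.one_mulVec, sub_eq_zero] at this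
  exact ⟨fixed, (hΨ i).exists_localOp_seg_mulVec_eq_zero ⟨1, by rw [fixed, one_smul]⟩ (hA i)
    (hA_nonempty i) (hA_compl i)⟩

theorem pow_le_of_mmis_mem_shortRangeBipartiteMixtures {d L D r m n : ℕ} (hd : 2 ≤ d)
    (hm : 8 * (1 + D * r) = m) (hn : d ^ m = n + 1) (hmL : m ≤ L)
    (h : mmis d L ∈ shortRangeBipartiteMixtures d L D r) :
    (n + 1) ^ (L / m) ≤ L * (Nat.multichoose ((n + 1) * n) (L / m) * n ^ (L / m)) := by
  have hL : 0 < L := by omega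
  have : Nonempty (Fin d) := ⟨⟨0, by omega⟩⟩
  have card_seg_config : Fintype.card (seg L 0 m → Fin d) = n + 1 := by
    rw [Fintype.card_fun, Fintype.card_fin, Fintype.card_coe, card_seg hL 0 hmL, hn]
  obtain ⟨V, rank_le, hV⟩ := exists_rank_mmis_le_finrank_span hd h
  rw [hm] at hV
  have invariant (Φ) (hΦ : Φ ∈ V) (k : Fin (L / m)) (σ : Config d L) :
      Φ (σ ∘ ⇑(finRotate L ^ (m * k : ℕ))) = Φ σ := by
    have pow_mulVec (l : ℕ) : translation d L ^ l *ᵥ Φ = Φ := by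
      induction l with
      | zero => rw [pow_zero, Matrix.one_mulVec]
      | succ l ih => rw [pow_succ, ← Matrix.mulVec_mulVec, (hV Φ hΦ).1, ih]
    exact congrFun ((translation_pow_mulVec _ Φ).symm.trans (pow_mulVec _)) σ
  have count := finrank_span_mul_pow_le injective_finRotate_pow_seg card_seg_config
    (g := fun k : Fin (L / m) => finRotate L ^ (m * k : ℕ)) invariant fun Φ hΦ => (hV Φ hΦ).2
  refine Nat.le_of_mul_le_mul_left ?_ (Fintype.card_pos : 0 < Fintype.card (Config d L))
  calc Fintype.card (Config d L) * (n + 1) ^ (L / m)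
      ≤ L * (mmis d L).rank * (n + 1) ^ (L / m) := by
        gcongr
        exact rank_mmis (by omega : 0 < d) hL ▸ card_config_le_mul_rank hL
    _ ≤ L * (Module.finrank ℂ (Submodule.span ℂ V) * (n + 1) ^ (L / m)) := by
        rw [mul_assoc]
        gcongr
    _ ≤ L * _ := Nat.mul_le_mul_left L count
    _ = _ := by ring

theorem mmis_notMem_shortRangeBipartiteMixtures {d : ℕ} (hd : 2 ≤ d) (D r : ℕ) :
    ∃ L₀ : ℕ, ∀ L ≥ L₀, mmis d L ∉ shortRangeBipartiteMixtures d L D r := by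
  obtain ⟨m, hm⟩ : ∃ m, 8 * (1 + D * r) = m := ⟨_, rfl⟩
  obtain ⟨n, hn⟩ : ∃ n, d ^ m = n + 1 := Nat.exists_eq_add_one.2 (Nat.pow_pos (by omega))
  obtain ⟨N₀, hN₀⟩ := exists_forall_mul_multichoose_mul_pow_lt ((n + 1) * n) m n
  have m_pos : 0 < m := by omega
  refine ⟨m * (N₀ + 1), fun L hL h => ?_⟩
  have le_div : N₀ + 1 ≤ L / m := (Nat.le_div_iff_mul_le m_pos).2 (by rwa [mul_comm])
  have m_le : m ≤ L := (Nat.le_mul_of_pos_right m N₀.succ_pos).trans hL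
  have L_le : L ≤ m * (L / m + 1) := (Nat.lt_mul_div_succ L m_pos).le
  exact (hN₀ (L / m) (by omega)).not_ge <|
    (pow_le_of_mmis_mem_shortRangeBipartiteMixtures hd hm hn m_le h).trans
      (Nat.mul_le_mul_right _ L_le)

end TranslationMMIS

end

theorem mainTheorem5 (d : ℕ) (hd : 2 ≤ d) (D r : ℕ) :
    (∃ L₀ : ℕ, ∀ L : ℕ, L₀ ≤ L →
      TranslationMMIS.mmis d L ∉ TranslationMMIS.shortRangeBipartiteMixtures d L D r) ∧
    (∃ ℓ D' r' : ℕ, ∀ (L : ℕ) (A : Finset (Fin L)) (Ψ : TranslationMMIS.Ket d L),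
      TranslationMMIS.IsArc A → ℓ ≤ A.card → ℓ ≤ Aᶜ.card →
      TranslationMMIS.IsTranslationSymmetric Ψ →
      TranslationMMIS.IsCircuitOfBipartiteProduct D r A Ψ →
      TranslationMMIS.IsCircuitOfProductState D' r' Ψ) :=
  ⟨TranslationMMIS.mmis_notMem_shortRangeBipartiteMixtures hd D r,
    6 * (1 + D * r), 2, 4 * (1 + D * r), fun _ _ _ hA hcard hcard' hΨ h =>
      hΨ.isCircuitOfProductState (by omega) hA hcard hcard' h⟩
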